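/- Let $\omega>0$, $t>0$, $g\in\mathbb{R}$. For $\psi=(\psi_+,\psi_-)\in L^2(\mathbb{R},\mathbb{C}^2)$ write $|\psi|^2=|\psi_+|^2+|\psi_-|^2$, $|\psi'|^2=|\psi_+'|^2+|\psi_-'|^2$ (weak derivatives), and let $Q_0$ be the set of those $\psi$ with $\psi'\in L^2$ and $x\psi\in L^2$. For $\lambda\in\mathbb{R}$ and $\psi\in Q_0$ let $$\langle \hat H_0^\lambda\rangle_\psi=\frac12\int|\psi'|^2\,dx+\frac{\omega^2}{2}\int x^2|\psi|^2\,dx-2t\,\mathrm{Re}\int\overline{\psi_+}\,\psi_-\,dx+\lambda g\int x\,(|\psi_+|^2-|\psi_-|^2)\,dx$$ be the energy of the quantum Rabi model with coupling $\lambda g$. For $(\sigma,\xi)\in[-1,1]\times\mathbb{R}$ let $\mathcal{M}_{\sigma,\xi}$ be the set of all $\psi\in Q_0$ with $\|\psi\|=1$, $\|\psi_+\|^2-\|\psi_-\|^2=\sigma$ and $\int x|\psi|^2\,dx=\xi$, and let $$F_{\mathrm{LL}}^\lambda(\sigma,\xi)=\inf_{\psi\in\mathcal{M}_{\sigma,\xi}}\langle\hat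 H_0^\lambda\rangle_\psi$$ be the Levy--Lieb functional; a $\psi\in\mathcal{M}_{\sigma,\xi}$ that attains the infimum is called an optimizer of $F_{\mathrm{LL}}^\lambda(\sigma,\xi)$. Let $\sigma\in[-1,1]$. For every $\nu\in\mathbb{R}$ the functional $F_{\mathrm{LL}}^\nu(\sigma,0)$ has an optimizer whose two components are real-valued and non-negative. Moreover, for every $\lambda\ge 0$ and every choice of real-valued optimizers $\varphi^\nu=(\varphi^\nu_+,\varphi^\nu_-)$ of $F_{\mathrm{LL}}^\nu(\sigma,0)$, $\nu\in[0,\lambda]$, the function $\nu\mapsto\int{\varphi^\nu_+}'\varphi^\nu_-\,dx$ is integrable on $[0,\lambda]$ and, for all $\xi\in\mathbb{R}$, the infimum $F_{\mathrm{LL}}^\lambda(\sigma,\xi)$ is finite and equal to $$F_{\mathrm{LL}}^\lambda(\sigma,\xi)=\frac{\omega}{2}-t\sqrt{1-\sigma^2}+\frac{\omega^2}{2}\xi^2+\lambda g\sigma\xi-\frac{\lambda^2g^2}{2\omega^2}(1-\sigma^2)+I^\lambda(\sigma),$$ where the only non-explicit contribution, which does not depend on $\xi$, is $$I^\lambda(\sigma)=-\frac{4tg}{\omega^2}\int_0^\lambda\int{\varphi^\nu_+}'\varphi^\nu_-\,dx\,d\nu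 .$$ -/

import Mathlib

namespace QRabi

open MeasureTheory

/-- The component space `L²(ℝ, ℂ)`. -/
abbrev L2 : Type := Lp ℂ 2 (volume : Measure ℝ)

/-- The state space `L²(ℝ, ℂ²) ≃ L²(ℝ, ℂ) × L²(ℝ, ℂ)` with its Hilbert norm
`‖ψ‖² = ‖ψ₊‖² + ‖ψ₋‖²`; here `ψ.fst` is the component `ψ₊` and `ψ.snd` is `ψ₋`. -/
abbrev State : Type := WithLp 2 (L2 × L2)

/-- `f' ∈ L²` is the weak (distributional) derivative of `f ∈ L²`. -/
def HasWeakDeriv (f f' : L2) : Prop :=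
  ∀ η : ℝ → ℝ, ContDiff ℝ ((⊤ : ℕ∞) : WithTop ℕ∞) η → HasCompactSupport η →
    ∫ x, deriv η x • f x = -∫ x, η x • f' x

theorem HasWeakDeriv.unique {f f₁ f₂ : L2} (h₁ : HasWeakDeriv f f₁)
    (h₂ : HasWeakDeriv f f₂) : f₁ = f₂ := by
  have hloc : ∀ u : L2, LocallyIntegrable (fun x => u x) volume := fun u =>
    (Lp.memLp u).locallyIntegrable (by norm_num)
  apply Lp.ext
  have h0 : ∀ᵐ x ∂(volume : Measure ℝ), f₁ x - f₂ x = 0 := by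
    refine ae_eq_zero_of_integral_contDiff_smul_eq_zero (μ := volume)
      ((hloc f₁).sub (hloc f₂)) ?_
    intro η hη hc
    have i₁ : Integrable (fun x => η x • f₁ x) volume :=
      (hloc f₁).integrable_smul_left_of_hasCompactSupport hη.continuous hc
    have i₂ : Integrable (fun x => η x • f₂ x) volume :=
      (hloc f₂).integrable_smul_left_of_hasCompactSupport hη.continuous hc
    have e : ∫ x, η x • f₁ x = ∫ x, η x • f₂ x :=
      neg_injective ((h₁ η hη hc).symm.trans (h₂ η hη hc))
    have hs : ∫ x, η x • (f₁ x - f₂ x) = 0 := by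
      simp only [smul_sub]
      rw [integral_sub i₁ i₂, e, sub_self]
    exact hs
  filter_upwards [h0] with x hx using sub_eq_zero.mp hx

open Classical in
/-- The weak derivative `f'` of `f`, if it exists in `L²` (and the value `0` otherwise; it is
only used where it exists). -/
noncomputable def weakDeriv (f : L2) : L2 :=
  if h : ∃ f', HasWeakDeriv f f' then h.choose else 0

theorem HasWeakDeriv.weakDeriv_eq {f f' : L2} (h : HasWeakDeriv f f') : weakDeriv f = f' := by
  have hex : ∃ f', HasWeakDeriv f f' := ⟨f', h⟩
  rw [weakDeriv, dif_pos hex]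
  exact hex.choose_spec.unique h

/-- A component `f ∈ L²` has finite oscillator energy: `f' ∈ L²` and `x f ∈ L²`. -/
def FiniteEnergy (f : L2) : Prop :=
  (∃ f', HasWeakDeriv f f') ∧ MemLp (fun x : ℝ => x • f x) 2 volume

/-- The admissible states `Q₀`: those with `‖p̂ ψ‖, ‖x̂ ψ‖ < ∞`. -/
def Q₀ : Set State := {ψ | FiniteEnergy ψ.fst ∧ FiniteEnergy ψ.snd}

/-- `⟨p̂²⟩ = ∫ |ψ'|²`. -/
noncomputable def expP2 (ψ : State) : ℝ :=
  ∫ x, (‖weakDeriv ψ.fst x‖ ^ 2 + ‖weakDeriv ψ.snd x‖ ^ 2)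

/-- `⟨x̂²⟩ = ∫ x² |ψ|²`. -/
noncomputable def expX2 (ψ : State) : ℝ :=
  ∫ x, x ^ 2 * (‖ψ.fst x‖ ^ 2 + ‖ψ.snd x‖ ^ 2)

/-- `⟨σ̂_x⟩ = 2 Re ∫ ψ₊^* ψ₋`. -/
noncomputable def expSigmaX (ψ : State) : ℝ :=
  2 * (∫ x, (starRingEnd ℂ) (ψ.fst x) * ψ.snd x).re

/-- `⟨σ̂_z x̂⟩ = ∫ x (|ψ₊|² - |ψ₋|²)`. -/
noncomputable def expSigmaZX (ψ : State) : ℝ :=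
  ∫ x, x * (‖ψ.fst x‖ ^ 2 - ‖ψ.snd x‖ ^ 2)

/-- The polarization `σ_ψ = ⟨σ̂_z⟩ = ‖ψ₊‖² - ‖ψ₋‖²`. -/
noncomputable def polarization (ψ : State) : ℝ := ‖ψ.fst‖ ^ 2 - ‖ψ.snd‖ ^ 2

/-- The displacement `ξ_ψ = ⟨x̂⟩ = ∫ x |ψ|²`. -/
noncomputable def displacement (ψ : State) : ℝ :=
  ∫ x, x * (‖ψ.fst x‖ ^ 2 + ‖ψ.snd x‖ ^ 2)

/-- The expectation value of the internal Hamiltonian at scaled coupling,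
`Ĥ₀^λ = p̂²/2 + ω² x̂²/2 - t σ̂_x + λ g σ̂_z x̂`, as a quadratic form on `Q₀`. -/
noncomputable def energy (ω t g lam : ℝ) (ψ : State) : ℝ :=
  1 / 2 * expP2 ψ + ω ^ 2 / 2 * expX2 ψ - t * expSigmaX ψ + lam * g * expSigmaZX ψ

/-- The constraint manifold `M_{σ,ξ}`. -/
def constraintSet (σ ξ : ℝ) : Set State :=
  {ψ | ψ ∈ Q₀ ∧ ‖ψ‖ = 1 ∧ polarization ψ = σ ∧ displacement ψ = ξ}

/-- The Levy--Lieb functional `F_LL^λ(σ,ξ) = inf_{ψ ∈ M_{σ,ξ}} ⟨ψ, Ĥ₀^λ ψ⟩`. -/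
noncomputable def levyLieb (ω t g lam σ ξ : ℝ) : ℝ :=
  sInf (energy ω t g lam '' constraintSet σ ξ)

/-- `ψ` is an optimizer of `F_LL^λ(σ,ξ)`: it attains the infimum over `M_{σ,ξ}`. -/
def IsOptimizer (ω t g lam σ ξ : ℝ) (ψ : State) : Prop :=
  ψ ∈ constraintSet σ ξ ∧ ∀ χ ∈ constraintSet σ ξ, energy ω t g lam ψ ≤ energy ω t g lam χ

/-- Both components of `ψ` are real-valued (almost everywhere). -/
def IsRealValued (ψ : State) : Prop :=
  ∀ᵐ x ∂(volume : Measure ℝ), (ψ.fst x).im = 0 ∧ (ψ.snd x).im = 0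

/-- Both components of `ψ` are real-valued and non-negative (almost everywhere). -/
def IsNonneg (ψ : State) : Prop :=
  ∀ᵐ x ∂(volume : Measure ℝ),
    ((ψ.fst x).im = 0 ∧ 0 ≤ (ψ.fst x).re) ∧ ((ψ.snd x).im = 0 ∧ 0 ≤ (ψ.snd x).re)

/-- `∫ ψ₊' ψ₋ dx`, which is a real number for real-valued `ψ ∈ Q₀`. -/
noncomputable def hopping (ψ : State) : ℝ :=
  (∫ x, weakDeriv ψ.fst x * ψ.snd x).re

/-- `I^λ = -(4 t g / ω²) ∫₀^λ ∫ φ₊^ν' φ₋^ν dx dν` for a family of states `ν ↦ φ^ν`. -/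
noncomputable def nonExplicit (ω t g lam : ℝ) (φ : ℝ → State) : ℝ :=
  -(4 * t * g / ω ^ 2) * ∫ ν in (0 : ℝ)..lam, hopping (φ ν)

end QRabi

/-! The formula comes from integrating the optimal energy along the coupling at ξ = 0. Translating
both components together changes the energy by an explicit amount, which reduces every ξ to ξ = 0
(`IsOptimizer.isLeast_translate`).

Write E(ν) for the energy of `φ ν` at coupling ν. The energy of a fixed state is affine in ν with
slope g⟨σ_z x⟩, so using `φ a` as a trial state at coupling b shows that g⟨σ_z x⟩ at `φ a` is a
supergradient of E at a. Supergradients are antitone, hence integrable for any choice of optimizers,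
and E(λ) − E(0) is their integral (`antitoneOn_and_integral_eq_of_supergradient`).

Translating the two components of an optimizer in opposite directions, with displacement kept at
zero, is an admissible variation. Its stationarity condition expresses ⟨σ_z x⟩ through the hopping
integral ∫ φ₊'φ₋ and an explicit term linear in ν (`IsOptimizer.expSigmaZX_eq`); that linear term
integrates to the λ²g² contribution. At ν = 0 the oscillator bound and Cauchy–Schwarz determine E(0)
(`IsOptimizer.energy_eq_of_coupling_eq_zero`).

Optimizers exist by the direct method: bounded oscillator energy gives compactness
(`exists_subseq_of_oscillator`). Replacing components by their absolute values makes an optimizer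
non-negative without raising the energy (`IsOptimizer.exists_isNonneg`). Weak derivatives are
handled throughout as strong derivatives of the translation group on L². -/

namespace QRabi

open MeasureTheory Filter Topology

/-! ### Translations on L² and weak derivatives. -/

/-- The translation `f ↦ f (· + a)` on `L²(ℝ, ℂ)`. -/
noncomputable def translate (a : ℝ) : L2 →ₗᵢ[ℂ] L2 :=
  Lp.compMeasurePreservingₗᵢ ℂ (fun x => x + a) (measurePreserving_add_right volume a)

theorem coeFn_translate (a : ℝ) (f : L2) : ∀ᵐ x : ℝ, translate a f x = f (x + a) :=
  Lp.coeFn_compMeasurePreserving f (measurePreserving_add_right volume a)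

theorem translate_zero (f : L2) : translate 0 f = f := by
  apply Lp.ext
  filter_upwards [coeFn_translate 0 f] with x hx
  rw [hx, add_zero]

theorem translate_translate (a b : ℝ) (f : L2) :
    translate a (translate b f) = translate (a + b) f := by
  apply Lp.ext
  have h := (measurePreserving_add_right (volume : Measure ℝ) a).quasiMeasurePreserving.ae
    (coeFn_translate b f)
  filter_upwards [coeFn_translate a (translate b f), coeFn_translate (a + b) f, h] with x h1 h2 h3
  rw [h1, h2, h3, add_assoc]

theorem continuous_translate (f : L2) : Continuous fun a => translate a f := by
  have hg : Continuous fun a : ℝ => (⟨fun x => x + a, by fun_prop⟩ : C(ℝ, ℝ)) :=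
    ContinuousMap.continuous_of_continuous_uncurry _
      (by unfold Function.uncurry; exact continuous_snd.add continuous_fst)
  exact (continuous_const (y := f)).compMeasurePreservingLp hg
    (fun a => measurePreserving_add_right volume a) (by norm_num)

theorem inner_translate (a : ℝ) (f g : L2) :
    inner ℂ (translate a f) (translate a g) = inner ℂ f g :=
  (translate a).inner_map_map f g

/-- The class in `L²` of a continuous real function of compact support. -/
noncomputable def testL2 (η : ℝ → ℝ) (hη : Continuous η) (hc : HasCompactSupport η) : L2 :=
  ((Complex.continuous_ofReal.comp hη).memLp_of_hasCompactSupport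
    (hc.comp_left Complex.ofReal_zero) (p := 2) (μ := volume)).toLp _

theorem inner_testL2 {η : ℝ → ℝ} (hη : Continuous η) (hc : HasCompactSupport η) (f : L2) :
    inner ℂ (testL2 η hη hc) f = ∫ x, η x • f x := by
  rw [L2.inner_def]
  apply integral_congr_ae
  filter_upwards [MemLp.coeFn_toLp ((Complex.continuous_ofReal.comp hη).memLp_of_hasCompactSupport
    (hc.comp_left Complex.ofReal_zero) (p := 2) (μ := volume))] with x hx
  rw [testL2, hx]
  simp [mul_comm]

theorem L2.locallyIntegrable (f : L2) : LocallyIntegrable (fun x => f x) volume :=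
  (Lp.memLp f).locallyIntegrable (by norm_num)

theorem L2.eq_of_test {f g : L2} (h : ∀ η : ℝ → ℝ, ContDiff ℝ ((⊤ : ℕ∞) : WithTop ℕ∞) η →
    HasCompactSupport η → ∫ x, η x • f x = ∫ x, η x • g x) : f = g :=
  Lp.ext (ae_eq_of_integral_contDiff_smul_eq (L2.locallyIntegrable f) (L2.locallyIntegrable g) h)

theorem integral_smul_translate (a : ℝ) (η : ℝ → ℝ) (f : L2) :
    ∫ x, η x • translate a f x = ∫ x, η (x - a) • f x := by
  rw [← integral_add_right_eq_self (fun x => η (x - a) • f x) a]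
  apply integral_congr_ae
  filter_upwards [coeFn_translate a f] with x hx
  rw [hx, add_sub_cancel_right]

theorem deriv_comp_sub_right (η : ℝ → ℝ) (a : ℝ) :
    deriv (fun x => η (x - a)) = fun x => deriv η (x - a) :=
  funext fun x => deriv_comp_sub_const (f := η) a x

theorem HasWeakDeriv.translate {f f' : L2} (h : HasWeakDeriv f f') (a : ℝ) :
    HasWeakDeriv (translate a f) (translate a f') := by
  intro η hη hc
  rw [integral_smul_translate, integral_smul_translate]
  have h2 := h (fun x => η (x - a)) (hη.comp (contDiff_id.sub contDiff_const))
    (hc.comp_homeomorph (Homeomorph.subRight a))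
  rwa [deriv_comp_sub_right] at h2

theorem HasWeakDeriv.smul {f f' : L2} (h : HasWeakDeriv f f') (c : ℂ) :
    HasWeakDeriv (c • f) (c • f') := by
  intro η hη hc
  have e : ∀ (ζ : ℝ → ℝ) (u : L2), ∫ x, ζ x • (c • u) x = c * ∫ x, ζ x • u x := by
    intro ζ u
    rw [← integral_const_mul]
    apply integral_congr_ae
    filter_upwards [Lp.coeFn_smul c u] with x hx
    rw [hx, Pi.smul_apply, smul_eq_mul, mul_smul_comm]
  rw [e, e, h η hη hc, mul_neg]

/-- Pairings of translates with a test function are differentiable in the translation. -/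
theorem hasDerivAt_integral_smul_translate {η : ℝ → ℝ}
    (hη : ContDiff ℝ ((⊤ : ℕ∞) : WithTop ℕ∞) η) (hc : HasCompactSupport η) (f : L2) (a : ℝ) :
    HasDerivAt (fun s => ∫ x, η x • QRabi.translate s f x)
      (-∫ x, deriv η (x - a) • f x) a := by
  -- The pairing is the convolution of f with the reflected test function, evaluated at the
  -- translation parameter.
  have hη' : ContDiff ℝ 1 (fun x => η (-x)) := (hη.comp contDiff_neg).of_le (by norm_cast)
  have hc' : HasCompactSupport (fun x => η (-x)) := hc.comp_homeomorph (Homeomorph.neg ℝ)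
  have key := hc'.hasDerivAt_convolution_right (𝕜 := ℝ) (μ := volume)
    (ContinuousLinearMap.lsmul ℝ ℝ (E := ℂ)).flip (L2.locallyIntegrable f) hη' a
  have hd : deriv (fun x => η (-x)) = fun x => -deriv η (-x) :=
    funext fun x => deriv_comp_neg (f := η) x
  refine (key.congr_of_eventuallyEq (Eventually.of_forall fun s => ?_)).congr_deriv ?_
  · simp only [MeasureTheory.convolution_def]
    rw [integral_smul_translate]
    simp
  · simp only [MeasureTheory.convolution_def, hd, ← integral_neg]
    simp

theorem HasWeakDeriv.hasDerivAt_pairing {f f' : L2} (h : HasWeakDeriv f f') {η : ℝ → ℝ}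
    (hη : ContDiff ℝ ((⊤ : ℕ∞) : WithTop ℕ∞) η) (hc : HasCompactSupport η) (a : ℝ) :
    HasDerivAt (fun s => ∫ x, η x • QRabi.translate s f x)
      (∫ x, η x • QRabi.translate a f' x) a := by
  convert hasDerivAt_integral_smul_translate hη hc f a using 1
  have h2 := h.translate a η hη hc
  rw [integral_smul_translate a (deriv η)] at h2
  rw [h2, neg_neg]

/-- Tested against any η, both sides agree by the fundamental theorem of calculus for the scalar
pairing. The integral is a Bochner integral in L², so continuity of translations then upgrades weak
differentiability to norm differentiability. -/
theorem HasWeakDeriv.translate_eq_integral {f f' : L2} (h : HasWeakDeriv f f') (a : ℝ) :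
    QRabi.translate a f = f + ∫ r in (0 : ℝ)..a, QRabi.translate r f' := by
  apply L2.eq_of_test
  intro η hη hc
  have hcont := continuous_translate f'
  rw [← inner_testL2 hη.continuous hc (f + _), inner_add_right,
    ← innerSL_apply_apply ℂ _ (∫ r in (0 : ℝ)..a, QRabi.translate r f'),
    ← ContinuousLinearMap.intervalIntegral_comp_comm _ (hcont.intervalIntegrable 0 a)]
  simp only [innerSL_apply_apply]
  have hderiv : ∀ s ∈ Set.uIcc 0 a, HasDerivAt (fun s => ∫ x, η x • QRabi.translate s f x)
      (inner ℂ (testL2 η hη.continuous hc) (QRabi.translate s f')) s := by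
    intro s _
    rw [inner_testL2]
    exact h.hasDerivAt_pairing hη hc s
  rw [intervalIntegral.integral_eq_sub_of_hasDerivAt hderiv
    ((continuous_const.inner hcont).intervalIntegrable 0 a), inner_testL2, translate_zero]
  ring

theorem HasWeakDeriv.hasDerivAt_translate {f f' : L2} (h : HasWeakDeriv f f') (a : ℝ) :
    HasDerivAt (fun s => QRabi.translate s f) (QRabi.translate a f') a := by
  have hcont := continuous_translate f'
  have := (intervalIntegral.integral_hasDerivAt_right (hcont.intervalIntegrable 0 a)
    hcont.aestronglyMeasurable.stronglyMeasurableAtFilter hcont.continuousAt).const_add f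
  exact this.congr_of_eventuallyEq (Eventually.of_forall fun s => h.translate_eq_integral s)

theorem HasWeakDeriv.norm_translate_sub_le {f f' : L2} (h : HasWeakDeriv f f') (a : ℝ) :
    ‖QRabi.translate a f - f‖ ≤ ‖f'‖ * |a| := by
  rw [h.translate_eq_integral a, add_sub_cancel_left]
  refine (intervalIntegral.norm_integral_le_of_norm_le_const (C := ‖f'‖) ?_).trans ?_
  · intro x _
    exact ((QRabi.translate x).norm_map f').le
  · rw [sub_zero]

/-! ### Weak convergence. -/

/-- Weak convergence of a sequence in a complex inner product space. -/
def WeakTendsto {H : Type*} [NormedAddCommGroup H] [InnerProductSpace ℂ H] (u : ℕ → H) (v : H) :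
    Prop :=
  ∀ w : H, Tendsto (fun n => inner ℂ w (u n)) atTop (𝓝 (inner ℂ w v))

theorem hasWeakDeriv_of_weakTendsto {f f' : ℕ → L2} {g g' : L2}
    (h : ∀ n, HasWeakDeriv (f n) (f' n)) (hf : WeakTendsto f g) (hf' : WeakTendsto f' g') :
    HasWeakDeriv g g' := by
  intro η hη hc
  have hd : Continuous (deriv η) := hη.continuous_deriv (by norm_cast)
  have h1 := hf (testL2 (deriv η) hd hc.deriv)
  have h2 := (hf' (testL2 η hη.continuous hc)).neg
  simp only [inner_testL2] at h1 h2
  refine tendsto_nhds_unique h1 (h2.congr fun n => ?_)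
  rw [h n η hη hc]

/-- A weak limit of difference quotients is a weak derivative. -/
theorem hasWeakDeriv_of_difference_quotients {f f' : L2} {s : ℕ → ℝ} (hs : Tendsto s atTop (𝓝 0))
    (hs0 : ∀ n, s n ≠ 0)
    (h : WeakTendsto (fun n => (((s n)⁻¹ : ℝ) : ℂ) • (translate (s n) f - f)) f') :
    HasWeakDeriv f f' := by
  intro η hη hc
  have h1 := h (testL2 η hη.continuous hc)
  have h2 := hasDerivAt_integral_smul_translate hη hc f 0
  rw [hasDerivAt_iff_tendsto_slope] at h2
  have hs' : Tendsto s atTop (𝓝[≠] 0) :=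
    tendsto_nhdsWithin_iff.mpr ⟨hs, Eventually.of_forall hs0⟩
  have h3 := h2.comp hs'
  rw [inner_testL2] at h1
  have e := tendsto_nhds_unique h1 (h3.congr fun n => ?_)
  · simp only [sub_zero] at e
    rw [e, neg_neg]
  · rw [inner_smul_right, inner_sub_right, inner_testL2, inner_testL2]
    simp [slope_def_module, translate_zero, sub_eq_add_neg, mul_add]

theorem WeakTendsto.comp {H : Type*} [NormedAddCommGroup H] [InnerProductSpace ℂ H] {u : ℕ → H}
    {v : H} (h : WeakTendsto u v) {k : ℕ → ℕ} (hk : StrictMono k) :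
    WeakTendsto (fun n => u (k n)) v :=
  fun w => (h w).comp hk.tendsto_atTop

/-- Sequential Banach–Alaoglu, transported through the Riesz isomorphism; conjugation moves the
sequence into the second slot of the inner product. -/
theorem exists_weakTendsto_subseq {H : Type*} [NormedAddCommGroup H] [InnerProductSpace ℂ H]
    [CompleteSpace H] [TopologicalSpace.SeparableSpace H] {u : ℕ → H} {C : ℝ}
    (hu : ∀ n, ‖u n‖ ≤ C) :
    ∃ v : H, ‖v‖ ≤ C ∧ ∃ k : ℕ → ℕ, StrictMono k ∧ WeakTendsto (fun n => u (k n)) v := by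
  have hmem : ∀ n, StrongDual.toWeakDual (InnerProductSpace.toDual ℂ H (u n)) ∈
      WeakDual.toStrongDual ⁻¹' Metric.closedBall (0 : StrongDual ℂ H) C := by
    intro n
    simp [hu n]
  obtain ⟨ℓ, hℓ, k, hk, hlim⟩ := WeakDual.isSeqCompact_closedBall ℂ H 0 C hmem
  refine ⟨(InnerProductSpace.toDual ℂ H).symm (WeakDual.toStrongDual ℓ), ?_, k, hk, fun w => ?_⟩
  · simpa using hℓ
  · have h1 := ((WeakDual.eval_continuous (𝕜 := ℂ) w).tendsto ℓ).comp hlim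
    have h2 := (Complex.continuous_conj.tendsto _).comp h1
    have e : ℓ w = inner ℂ ((InnerProductSpace.toDual ℂ H).symm (WeakDual.toStrongDual ℓ)) w := by
      rw [InnerProductSpace.toDual_symm_apply]
      rfl
    rw [e, inner_conj_symm] at h2
    refine h2.congr fun n => ?_
    change (starRingEnd ℂ) (inner ℂ (u (k n)) w) = _
    rw [inner_conj_symm]

/-- The tangent inequality of the squared norm at v. Its left side is weakly continuous in u, which
is how weak lower semicontinuity enters the minimization. -/
theorem two_re_inner_sub_le_norm_sq {H : Type*} [NormedAddCommGroup H] [InnerProductSpace ℂ H]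
    (u v : H) : 2 * (inner ℂ v u).re - ‖v‖ ^ 2 ≤ ‖u‖ ^ 2 := by
  have h := norm_sub_sq (𝕜 := ℂ) v u
  have h2 := sq_nonneg ‖v - u‖
  rw [h] at h2
  simp only [RCLike.re_eq_complex_re] at h2
  linarith

theorem re_inner_self {H : Type*} [NormedAddCommGroup H] [InnerProductSpace ℂ H] (u : H) :
    (inner ℂ u u).re = ‖u‖ ^ 2 := by
  rw [inner_self_eq_norm_sq_to_K]
  norm_cast

theorem tendsto_inner_of_tendsto_of_weakTendsto {H : Type*} [NormedAddCommGroup H]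
    [InnerProductSpace ℂ H] {u w : ℕ → H} {u₀ w₀ : H} {C : ℝ} (hu : Tendsto u atTop (𝓝 u₀))
    (hw : WeakTendsto w w₀) (hC : ∀ n, ‖w n‖ ≤ C) :
    Tendsto (fun n => inner ℂ (u n) (w n)) atTop (𝓝 (inner ℂ u₀ w₀)) := by
  have h0 : Tendsto (fun n => inner ℂ (u n - u₀) (w n)) atTop (𝓝 0) := by
    refine squeeze_zero_norm (a := fun n => ‖u n - u₀‖ * C) (fun n => ?_) ?_
    · exact (norm_inner_le_norm _ _).trans
        (mul_le_mul_of_nonneg_left (hC n) (norm_nonneg _))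
    · have := (tendsto_iff_norm_sub_tendsto_zero.mp hu).mul_const C
      rwa [zero_mul] at this
  have h1 := h0.add (hw u₀)
  rw [zero_add] at h1
  refine h1.congr fun n => ?_
  rw [inner_sub_left, sub_add_cancel]

instance : TopologicalSpace.SeparableSpace L2 :=
  haveI : Fact ((2 : ENNReal) ≠ ⊤) := ⟨by norm_num⟩
  inferInstance

/-! ### The position operator and oscillator data. -/

/-- `g = x f` as elements of `L²`. -/
def IsPosMul (f g : L2) : Prop := ∀ᵐ x : ℝ, g x = x • f x

theorem IsPosMul.memLp {f g : L2} (h : IsPosMul f g) : MemLp (fun x : ℝ => x • f x) 2 volume :=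
  (memLp_congr_ae h).mp (Lp.memLp g)

theorem isPosMul_of_weakTendsto {f g : ℕ → L2} {f₀ g₀ : L2} (h : ∀ n, IsPosMul (f n) (g n))
    (hf : WeakTendsto f f₀) (hg : WeakTendsto g g₀) : IsPosMul f₀ g₀ := by
  have hli : LocallyIntegrable (fun x : ℝ => x • f₀ x) volume := by
    have := (L2.locallyIntegrable f₀).locallyIntegrableOn Set.univ
    exact locallyIntegrableOn_univ.mp
      (this.continuousOn_smul isOpen_univ.isLocallyClosed continuousOn_id)
  refine ae_eq_of_integral_contDiff_smul_eq (L2.locallyIntegrable g₀) hli ?_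
  intro η hη hc
  have hη' : Continuous fun x => η x * x := hη.continuous.mul continuous_id
  have hc' : HasCompactSupport fun x => η x * x := hc.mul_right
  have h1 := hg (testL2 η hη.continuous hc)
  have h2 := hf (testL2 _ hη' hc')
  simp only [inner_testL2] at h1 h2
  have e := tendsto_nhds_unique h1 (h2.congr fun n => ?_)
  · rw [e]
    simp only [mul_smul]
  · apply integral_congr_ae
    filter_upwards [h n] with x hx
    rw [hx, mul_smul]

theorem IsPosMul.inner_comm {f f' g g' : L2} (hf : IsPosMul f f') (hg : IsPosMul g g') :
    inner ℂ f' g = inner ℂ f g' := by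
  rw [L2.inner_def, L2.inner_def]
  apply integral_congr_ae
  filter_upwards [hf, hg] with x h1 h2
  rw [h1, h2]
  simp only [Complex.real_smul, RCLike.inner_apply, map_mul, Complex.conj_ofReal]
  ring

theorem IsPosMul.smul {f g : L2} (h : IsPosMul f g) (c : ℂ) : IsPosMul (c • f) (c • g) := by
  filter_upwards [h, Lp.coeFn_smul c f, Lp.coeFn_smul c g] with x h1 h2 h3
  rw [h2, h3, Pi.smul_apply, Pi.smul_apply, h1, smul_comm]

theorem IsPosMul.translate {f g : L2} (h : IsPosMul f g) (a : ℝ) :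
    IsPosMul (translate a f) (translate a g - (a : ℂ) • QRabi.translate a f) := by
  have h' := (measurePreserving_add_right (volume : Measure ℝ) a).quasiMeasurePreserving.ae h
  filter_upwards [h', coeFn_translate a f, coeFn_translate a g,
    Lp.coeFn_sub (QRabi.translate a g) ((a : ℂ) • QRabi.translate a f),
    Lp.coeFn_smul (a : ℂ) (QRabi.translate a f)] with x h1 h2 h3 h4 h5
  rw [h4, Pi.sub_apply, h5, Pi.smul_apply, h2, h3, h1]
  simp only [Complex.real_smul, smul_eq_mul, Complex.ofReal_add]
  ring

/-- `f'` is the weak derivative of `f` and `g = x f`. -/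
structure Oscillator (f f' g : L2) : Prop where
  hasWeakDeriv : HasWeakDeriv f f'
  isPosMul : IsPosMul f g

theorem FiniteEnergy.exists_oscillator {f : L2} (h : FiniteEnergy f) :
    ∃ f' g, Oscillator f f' g := by
  obtain ⟨⟨f', hf'⟩, hx⟩ := h
  exact ⟨f', hx.toLp _, hf', hx.coeFn_toLp⟩

theorem Oscillator.finiteEnergy {f f' g : L2} (h : Oscillator f f' g) : FiniteEnergy f :=
  ⟨⟨f', h.hasWeakDeriv⟩, h.isPosMul.memLp⟩

theorem Oscillator.translate {f f' g : L2} (h : Oscillator f f' g) (a : ℝ) :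
    Oscillator (translate a f) (QRabi.translate a f')
      (QRabi.translate a g - (a : ℂ) • QRabi.translate a f) :=
  ⟨h.hasWeakDeriv.translate a, h.isPosMul.translate a⟩

theorem Oscillator.smul {f f' g : L2} (h : Oscillator f f' g) (c : ℂ) :
    Oscillator (c • f) (c • f') (c • g) :=
  ⟨h.hasWeakDeriv.smul c, h.isPosMul.smul c⟩

/-! ### Absolute values. -/

/-- The pointwise absolute value of `f`, as an element of `L²(ℝ, ℂ)`. -/
noncomputable def absL2 (f : L2) : L2 :=
  (MemLp.ofReal (K := ℂ) (Lp.memLp f).norm).toLp _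

theorem coeFn_absL2 (f : L2) : ∀ᵐ x : ℝ, absL2 f x = (‖f x‖ : ℂ) :=
  MemLp.coeFn_toLp _

theorem L2.norm_le_of_ae {f g : L2} (h : ∀ᵐ x : ℝ, ‖f x‖ ≤ ‖g x‖) : ‖f‖ ≤ ‖g‖ :=
  Lp.norm_le_norm_of_ae_le h

theorem norm_absL2 (f : L2) : ‖absL2 f‖ = ‖f‖ := by
  apply le_antisymm <;> apply L2.norm_le_of_ae <;> filter_upwards [coeFn_absL2 f] with x hx <;>
    simp [hx]

theorem norm_absL2_sub_le (f g : L2) : ‖absL2 f - absL2 g‖ ≤ ‖f - g‖ := by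
  apply L2.norm_le_of_ae
  filter_upwards [coeFn_absL2 f, coeFn_absL2 g, Lp.coeFn_sub f g,
    Lp.coeFn_sub (absL2 f) (absL2 g)] with x h1 h2 h3 h4
  rw [h3, h4, Pi.sub_apply, Pi.sub_apply, h1, h2, ← Complex.ofReal_sub, Complex.norm_real]
  exact abs_norm_sub_norm_le _ _

theorem translate_absL2 (a : ℝ) (f : L2) : translate a (absL2 f) = absL2 (translate a f) := by
  apply Lp.ext
  have h' := (measurePreserving_add_right (volume : Measure ℝ) a).quasiMeasurePreserving.ae
    (coeFn_absL2 f)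
  filter_upwards [coeFn_translate a f, coeFn_translate a (absL2 f), coeFn_absL2 (translate a f),
    h'] with x h1 h2 h3 h4
  rw [h2, h3, h4, h1]

/-- Taking absolute values is a contraction commuting with translations, so the difference quotients
of |f| are bounded by ‖f'‖. A weak limit point of them is a weak derivative with the same bound. -/
theorem HasWeakDeriv.exists_absL2 {f f' : L2} (h : HasWeakDeriv f f') :
    ∃ g, HasWeakDeriv (absL2 f) g ∧ ‖g‖ ≤ ‖f'‖ := by
  set s : ℕ → ℝ := fun n => 1 / ((n : ℝ) + 1) with hs
  have hpos : ∀ n, 0 < s n := fun n => Nat.one_div_pos_of_nat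
  have hbound : ∀ n, ‖(((s n)⁻¹ : ℝ) : ℂ) • (QRabi.translate (s n) (absL2 f) - absL2 f)‖
      ≤ ‖f'‖ := by
    intro n
    have h1 : ‖QRabi.translate (s n) (absL2 f) - absL2 f‖ ≤ ‖f'‖ * s n := by
      rw [translate_absL2]
      refine (norm_absL2_sub_le _ _).trans ((h.norm_translate_sub_le (s n)).trans_eq ?_)
      rw [abs_of_pos (hpos n)]
    rw [norm_smul, Complex.norm_real, norm_inv, Real.norm_of_nonneg (hpos n).le,
      inv_mul_le_iff₀ (hpos n), mul_comm]
    exact h1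
  obtain ⟨g, hg, k, hk, hlim⟩ := exists_weakTendsto_subseq hbound
  exact ⟨g, hasWeakDeriv_of_difference_quotients (s := fun n => s (k n))
    (tendsto_one_div_add_atTop_nhds_zero_nat.comp hk.tendsto_atTop) (fun n => (hpos _).ne') hlim,
    hg⟩

theorem IsPosMul.exists_absL2 {f g : L2} (h : IsPosMul f g) :
    ∃ G, IsPosMul (absL2 f) G ∧ ‖G‖ = ‖g‖ ∧ inner ℂ (absL2 f) G = inner ℂ f g := by
  have hmem : MemLp (fun x : ℝ => x • absL2 f x) 2 volume := by
    refine (h.memLp.norm.congr_norm (f := fun x : ℝ => ‖x • f x‖) ?_ ?_)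
    · exact (continuous_id.aestronglyMeasurable).smul (Lp.aestronglyMeasurable _)
    · filter_upwards [coeFn_absL2 f] with x hx
      simp [hx]
  refine ⟨hmem.toLp _, hmem.coeFn_toLp, ?_, ?_⟩
  · apply le_antisymm <;> apply L2.norm_le_of_ae <;>
      filter_upwards [coeFn_absL2 f, hmem.coeFn_toLp, h] with x h1 h2 h3 <;>
      rw [h2, h3, h1, norm_smul, norm_smul, Complex.norm_real, norm_norm]
  · rw [L2.inner_def, L2.inner_def]
    apply integral_congr_ae
    filter_upwards [coeFn_absL2 f, hmem.coeFn_toLp, h] with x h1 h2 h3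
    rw [h2, h3, h1]
    simp only [Complex.real_smul, RCLike.inner_apply, Complex.conj_ofReal, mul_assoc,
      Complex.mul_conj']
    ring

theorem re_inner_le_re_inner_absL2 (f g : L2) :
    (inner ℂ f g).re ≤ (inner ℂ (absL2 f) (absL2 g)).re := by
  rw [L2.inner_def, L2.inner_def, ← RCLike.re_eq_complex_re,
    ← integral_re (L2.integrable_inner f g), ← integral_re (L2.integrable_inner _ _)]
  refine integral_mono_ae (L2.integrable_inner f g).re (L2.integrable_inner _ _).re ?_
  filter_upwards [coeFn_absL2 f, coeFn_absL2 g] with x h1 h2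
  rw [h1, h2]
  refine (Complex.re_le_norm _).trans_eq ?_
  simp [RCLike.inner_apply]

/-! ### Primitives, local averages and compactness. -/

/-- The indicator function of `(a, b]`. -/
noncomputable def indicatorL2 (a b : ℝ) : L2 :=
  indicatorConstLp 2 (measurableSet_Ioc (a := a) (b := b)) (by simp) (1 : ℂ)

theorem inner_indicatorL2 {a b : ℝ} (hab : a ≤ b) (f : L2) :
    inner ℂ (indicatorL2 a b) f = ∫ x in a..b, f x := by
  rw [indicatorL2, L2.inner_indicatorConstLp_one, intervalIntegral.integral_of_le hab]

theorem norm_indicatorL2 {a b : ℝ} (hab : a ≤ b) : ‖indicatorL2 a b‖ = √(b - a) := by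
  rw [indicatorL2, norm_indicatorConstLp (by norm_num) (by norm_num)]
  simp [Real.sqrt_eq_rpow, Measure.real, ENNReal.toReal_ofReal (sub_nonneg.mpr hab)]

theorem L2.intervalIntegrable (f : L2) (a b : ℝ) :
    IntervalIntegrable (fun x => f x) volume a b :=
  intervalIntegrable_iff.mpr (((L2.locallyIntegrable f).integrableOn_isCompact
    isCompact_uIcc).mono_set Set.uIoc_subset_uIcc)

theorem continuous_primitive (f : L2) : Continuous fun x => ∫ y in (0 : ℝ)..x, f y :=
  intervalIntegral.continuous_primitive (L2.intervalIntegrable f) 0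

theorem norm_integral_le_norm_mul_sqrt {a b : ℝ} (hab : a ≤ b) (f : L2) :
    ‖∫ x in a..b, f x‖ ≤ ‖f‖ * √(b - a) := by
  rw [← inner_indicatorL2 hab, ← norm_indicatorL2 hab, mul_comm]
  exact norm_inner_le_norm _ _

theorem intervalIntegral_translate (a b r : ℝ) (f : L2) :
    ∫ x in a..b, translate r f x = ∫ x in (a + r)..(b + r), f x := by
  rw [← intervalIntegral.integral_comp_add_right]
  refine intervalIntegral.integral_congr_ae ?_
  filter_upwards [coeFn_translate r f] with x hx _ using hx

/-- A weakly differentiable function agrees almost everywhere with a primitive of its weak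
derivative. -/
theorem HasWeakDeriv.exists_ae_eq {f f' : L2} (h : HasWeakDeriv f f') :
    ∃ c : ℂ, ∀ᵐ x : ℝ, f x = c + ∫ y in (0 : ℝ)..x, f' y := by
  set U : ℝ → ℂ := fun x => ∫ y in (0 : ℝ)..x, f y with hU
  set F : ℝ → ℂ := fun x => ∫ y in (0 : ℝ)..x, f' y with hF
  set Φ : ℝ → ℂ := fun x => ∫ y in (0 : ℝ)..x, F y with hΦ
  have hFc : Continuous F := continuous_primitive f'
  have hΦd : ∀ x, HasDerivAt Φ (F x) x := fun x =>
    intervalIntegral.integral_hasDerivAt_right (hFc.intervalIntegrable 0 x)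
      hFc.aestronglyMeasurable.stronglyMeasurableAtFilter hFc.continuousAt
  have hdiff : ∀ (u : L2) (a b : ℝ), ∫ x in a..b, u x
      = (∫ x in (0 : ℝ)..b, u x) - ∫ x in (0 : ℝ)..a, u x := fun u a b =>
    (intervalIntegral.integral_interval_sub_left (L2.intervalIntegrable u 0 b)
      (L2.intervalIntegrable u 0 a)).symm
  -- W should be x times a constant. Pairing translates of f with an interval's indicator shows that
  -- the increments of W do not depend on the base point; W is thus additive and continuous, hence
  -- linear, and differentiating at Lebesgue points of f recovers f.
  set W : ℝ → ℂ := fun x => U x - Φ x with hW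
  have hW0 : W 0 = 0 := by simp [hW, hU, hΦ]
  have hpos : ∀ b, 0 ≤ b → ∀ r, W (b + r) - W r = W b := by
    intro b hb r
    have hd : ∀ r, HasDerivAt (fun r => W (b + r) - W r) 0 r := by
      intro r
      have h1 := (hasDerivAt_const r (indicatorL2 0 b)).inner ℂ (h.hasDerivAt_translate r)
      simp only [inner_zero_left, add_zero, inner_indicatorL2 hb, intervalIntegral_translate,
        zero_add] at h1
      rw [hdiff f'] at h1
      have h2 := ((hΦd (b + r)).comp_const_add b r).sub (hΦd r)
      refine ((h1.sub h2).congr_deriv (sub_self _)).congr_of_eventuallyEq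
        (Eventually.of_forall fun s => ?_)
      simp only [hW, Pi.sub_apply]
      rw [hdiff f]
      ring
    have := is_const_of_deriv_eq_zero (fun r => (hd r).differentiableAt) (fun r => (hd r).deriv) r 0
    simpa [hW0] using this
  have hadd : ∀ b r, W (b + r) = W b + W r := by
    intro b r
    rcases le_total 0 b with hb | hb
    · rw [← hpos b hb r, sub_add_cancel]
    · have h1 := hpos (-b) (neg_nonneg.mpr hb) (b + r)
      have h2 := hpos (-b) (neg_nonneg.mpr hb) b
      rw [neg_add_cancel_left] at h1
      rw [neg_add_cancel, hW0] at h2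
      rw [← h2] at h1
      linear_combination -h1
  have hWc : Continuous W := (continuous_primitive f).sub
    (continuous_iff_continuousAt.mpr fun x => (hΦd x).continuousAt)
  have hlin : ∀ x : ℝ, W x = x • W 1 := by
    intro x
    have := ((AddMonoidHom.mk' W hadd).toRealLinearMap hWc).map_smul x 1
    rw [smul_eq_mul, mul_one] at this
    exact this
  refine ⟨W 1, ?_⟩
  filter_upwards [LocallyIntegrable.ae_hasDerivAt_integral (L2.locallyIntegrable f)] with x hx
  have h1 : HasDerivAt U (f x) x := hx 0
  have h2 : HasDerivAt U (W 1 + F x) x := by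
    refine ((((hasDerivAt_id x).smul_const (W 1)).add (hΦd x)).congr_deriv
      (by rw [one_smul])).congr_of_eventuallyEq (Eventually.of_forall fun s => ?_)
    simp only [Pi.add_apply, id]
    rw [← hlin s]
    simp [hW]
  exact h1.unique h2

/-- Since f' ∈ L², f is Hölder continuous of exponent 1/2. Pointwise values are therefore controlled
by pairings with indicators, which weak convergence sees. The exceptional null set is independent of
r. -/
theorem HasWeakDeriv.ae_norm_average_sub_le {f f' : L2} (h : HasWeakDeriv f f') :
    ∀ᵐ x : ℝ, ∀ r : ℝ, 0 < r →
      ‖inner ℂ (indicatorL2 x (x + r)) f - r • f x‖ ≤ ‖f'‖ * √r * r := by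
  obtain ⟨c, hc⟩ := h.exists_ae_eq
  filter_upwards [hc] with x hx r hr
  have hle : x ≤ x + r := by linarith
  have e : ∫ y in x..(x + r), f y = ∫ y in x..(x + r), (c + ∫ z in (0 : ℝ)..y, f' z) :=
    intervalIntegral.integral_congr_ae (by filter_upwards [hc] with y hy _ using hy)
  have hcont : Continuous fun y => c + ∫ z in (0 : ℝ)..y, f' z :=
    continuous_const.add (continuous_primitive f')
  have e2 : r • f x = ∫ y in x..(x + r), f x := by simp
  rw [inner_indicatorL2 hle, e, e2,
    ← intervalIntegral.integral_sub (hcont.intervalIntegrable _ _) (by simp)]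
  refine (intervalIntegral.norm_integral_le_of_norm_le_const (C := ‖f'‖ * √r) ?_).trans_eq ?_
  · intro y hy
    rw [Set.uIoc_of_le hle] at hy
    rw [hx, add_sub_add_left_eq_sub, intervalIntegral.integral_interval_sub_left
      (L2.intervalIntegrable f' _ _) (L2.intervalIntegrable f' _ _)]
    refine (norm_integral_le_norm_mul_sqrt hy.1.le f').trans ?_
    have : √(y - x) ≤ √r := Real.sqrt_le_sqrt (by linarith [hy.2])
    gcongr
  · rw [add_sub_cancel_left, abs_of_pos hr]

theorem L2.norm_sq_eq_integral (f : L2) : ‖f‖ ^ 2 = ∫ x, ‖f x‖ ^ 2 := by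
  rw [← re_inner_self, L2.inner_def, ← RCLike.re_eq_complex_re,
    ← integral_re (L2.integrable_inner f f)]
  simp only [inner_self_eq_norm_sq]

theorem L2.integrable_norm_sq (f : L2) : Integrable (fun x => ‖f x‖ ^ 2) volume :=
  (Lp.memLp f).norm.integrable_sq

/-- Bounds on the weak derivative and on the position turn weak into strong convergence. -/
theorem tendsto_zero_of_weakTendsto {f f' g : ℕ → L2} {C : ℝ}
    (h : ∀ n, Oscillator (f n) (f' n) (g n)) (hf : WeakTendsto f 0) (hC : ∀ n, ‖f n‖ ≤ C) (hC' : ∀ n, ‖f' n‖ ≤ C)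
    (hCg : ∀ n, ‖g n‖ ≤ C) : Tendsto f atTop (𝓝 0) := by
  have hC0 : 0 ≤ C := (norm_nonneg _).trans (hC 0)
  have hae : ∀ᵐ x : ℝ, ∀ n, ∀ r : ℝ, 0 < r →
      ‖inner ℂ (indicatorL2 x (x + r)) (f n) - r • f n x‖ ≤ C * √r * r := by
    rw [ae_all_iff]
    intro n
    filter_upwards [(h n).hasWeakDeriv.ae_norm_average_sub_le] with x hx r hr
    refine (hx r hr).trans ?_
    have := hC' n
    gcongr
  have hpt : ∀ᵐ x : ℝ, Tendsto (fun n => ‖f n x‖ ^ 2) atTop (𝓝 0) := by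
    filter_upwards [hae] with x hx
    have : Tendsto (fun n => ‖f n x‖) atTop (𝓝 0) := by
      rw [Metric.tendsto_atTop]
      intro ε hε
      obtain ⟨r, hr, hrε⟩ : ∃ r : ℝ, 0 < r ∧ C * √r < ε / 2 := by
        -- The `C + 1` covers the case C = 0 and makes C√r strictly less than ε/2.
        refine ⟨(ε / (2 * (C + 1))) ^ 2 , by positivity, ?_⟩
        rw [Real.sqrt_sq (by positivity), mul_div_assoc', div_lt_div_iff₀ (by positivity) two_pos]
        nlinarith
      obtain ⟨N, hN⟩ := Metric.tendsto_atTop.mp (hf (indicatorL2 x (x + r))) (r * (ε / 2))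
        (by positivity)
      refine ⟨N, fun n hn => ?_⟩
      have h1 := hN n hn
      rw [inner_zero_right, dist_zero_right] at h1
      have h2 := hx n r hr
      have h3 : ‖r • f n x‖ ≤ ‖inner ℂ (indicatorL2 x (x + r)) (f n)‖
          + ‖inner ℂ (indicatorL2 x (x + r)) (f n) - r • f n x‖ := norm_le_norm_add_norm_sub _ _
      rw [norm_smul, Real.norm_of_nonneg hr.le] at h3
      rw [dist_zero_right, norm_norm]
      have h4 : C * √r * r < ε / 2 * r := by gcongr
      have h5 : r * ‖f n x‖ < r * ε := by linarith
      exact lt_of_mul_lt_mul_left h5 hr.le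
    simpa using this.pow 2
  -- Averaging over an interval of length 1 gives a uniform bound, the dominating function on
  -- bounded intervals.
  have hbd : ∀ n, ∀ᵐ x : ℝ, ‖f n x‖ ^ 2 ≤ (2 * C) ^ 2 := by
    intro n
    filter_upwards [hae] with x hx
    have h2 := hx n 1 one_pos
    have h3 := norm_le_norm_add_norm_sub (inner ℂ (indicatorL2 x (x + 1)) (f n)) ((1 : ℝ) • f n x)
    have h4 := norm_inner_le_norm (𝕜 := ℂ) (indicatorL2 x (x + 1)) (f n)
    rw [norm_indicatorL2 (by linarith), add_sub_cancel_left] at h4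
    simp only [Real.sqrt_one, one_mul, mul_one, one_smul] at h2 h3 h4
    have h5 := hC n
    have : ‖f n x‖ ≤ 2 * C := by linarith
    gcongr
  have hloc : ∀ R : ℝ, Tendsto (fun n => ∫ x in Set.Ioc (-R) R, ‖f n x‖ ^ 2) atTop (𝓝 0) := by
    intro R
    have := tendsto_integral_of_dominated_convergence
      (μ := volume.restrict (Set.Ioc (-R) R)) (F := fun n x => ‖f n x‖ ^ 2) (f := fun _ => 0)
      (fun _ => (2 * C) ^ 2)
      (fun n => (L2.integrable_norm_sq (f n)).aestronglyMeasurable.restrict)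
      (integrable_const _) (fun n => ?_) (ae_restrict_of_ae hpt)
    · simpa using this
    · filter_upwards [ae_restrict_of_ae (hbd n)] with x hx
      rwa [Real.norm_of_nonneg (by positivity)]
  -- The bound on x f controls the mass outside [-R, R], uniformly in n.
  have htail : ∀ R : ℝ, 0 < R → ∀ n,
      ‖f n‖ ^ 2 ≤ (∫ x in Set.Ioc (-R) R, ‖f n x‖ ^ 2) + C ^ 2 / R ^ 2 := by
    intro R hR n
    rw [L2.norm_sq_eq_integral, ← integral_add_compl (measurableSet_Ioc (a := -R) (b := R))
      (L2.integrable_norm_sq (f n))]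
    gcongr
    have hg : ∫ x in (Set.Ioc (-R) R)ᶜ, ‖f n x‖ ^ 2 ≤ ∫ x in (Set.Ioc (-R) R)ᶜ,
        ‖g n x‖ ^ 2 / R ^ 2 := by
      refine setIntegral_mono_on_ae (L2.integrable_norm_sq (f n)).integrableOn
        ((L2.integrable_norm_sq (g n)).div_const _).integrableOn measurableSet_Ioc.compl ?_
      filter_upwards [(h n).isPosMul] with x hx hxR
      rw [hx, norm_smul, mul_pow, le_div_iff₀ (by positivity), mul_comm, Real.norm_eq_abs, sq_abs]
      have : R ^ 2 ≤ x ^ 2 := by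
        simp only [Set.mem_compl_iff, Set.mem_Ioc, not_and_or, not_lt, not_le] at hxR
        rcases hxR with h1 | h1 <;> nlinarith
      gcongr
    refine hg.trans ((setIntegral_le_integral ((L2.integrable_norm_sq (g n)).div_const _)
      (Eventually.of_forall fun x => by positivity)).trans ?_)
    rw [integral_div, ← L2.norm_sq_eq_integral]
    have := hCg n
    gcongr
  have hsq : Tendsto (fun n => ‖f n‖ ^ 2) atTop (𝓝 0) := by
    rw [Metric.tendsto_atTop]
    intro ε hε
    obtain ⟨R, hR, hRε⟩ : ∃ R : ℝ, 0 < R ∧ C ^ 2 / R ^ 2 < ε / 2 := by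
      have : Tendsto (fun R : ℝ => C ^ 2 / R ^ 2) atTop (𝓝 0) :=
        tendsto_const_nhds.div_atTop (tendsto_pow_atTop two_ne_zero)
      obtain ⟨R, h1, h2⟩ := ((eventually_gt_atTop 0).and
        (this.eventually_lt_const (half_pos hε))).exists
      exact ⟨R, h1, h2⟩
    obtain ⟨N, hN⟩ := eventually_atTop.mp ((hloc R).eventually_lt_const (half_pos hε))
    refine ⟨N, fun n hn => ?_⟩
    rw [dist_zero_right, Real.norm_of_nonneg (by positivity)]
    linarith [htail R hR n, hN n hn]
  rw [tendsto_zero_iff_norm_tendsto_zero]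
  have := hsq.sqrt
  simpa using this

theorem HasWeakDeriv.sub {f f' g g' : L2} (h : HasWeakDeriv f f') (hg : HasWeakDeriv g g') :
    HasWeakDeriv (f - g) (f' - g') := by
  intro η hη hc
  have hd : Continuous (deriv η) := hη.continuous_deriv (by norm_cast)
  have h1 := h η hη hc
  have h2 := hg η hη hc
  simp only [← inner_testL2 hd hc.deriv, ← inner_testL2 hη.continuous hc] at h1 h2 ⊢
  rw [inner_sub_right, inner_sub_right, h1, h2]
  ring

theorem IsPosMul.sub {f f' g g' : L2} (h : IsPosMul f f') (hg : IsPosMul g g') :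
    IsPosMul (f - g) (f' - g') := by
  filter_upwards [h, hg, Lp.coeFn_sub f g, Lp.coeFn_sub f' g'] with x h1 h2 h3 h4
  rw [h3, h4, Pi.sub_apply, Pi.sub_apply, h1, h2, smul_sub]

/-- Compactness of sets of bounded oscillator energy. -/
theorem exists_subseq_of_oscillator {f f' g : ℕ → L2} {C : ℝ}
    (h : ∀ n, Oscillator (f n) (f' n) (g n)) (hC : ∀ n, ‖f n‖ ≤ C) (hC' : ∀ n, ‖f' n‖ ≤ C)
    (hCg : ∀ n, ‖g n‖ ≤ C) :
    ∃ k : ℕ → ℕ, StrictMono k ∧ ∃ u u' v, Oscillator u u' v ∧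
      Tendsto (fun n => f (k n)) atTop (𝓝 u) ∧ WeakTendsto (fun n => f' (k n)) u' ∧
      WeakTendsto (fun n => g (k n)) v := by
  obtain ⟨u, hu, k₁, hk₁, h₁⟩ := exists_weakTendsto_subseq hC
  obtain ⟨u', hu', k₂, hk₂, h₂⟩ := exists_weakTendsto_subseq (fun n => hC' (k₁ n))
  obtain ⟨v, hv, k₃, hk₃, h₃⟩ := exists_weakTendsto_subseq (fun n => hCg (k₁ (k₂ n)))
  have h₁' := (h₁.comp hk₂).comp hk₃
  have h₂' := h₂.comp hk₃
  have hosc : Oscillator u u' v :=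
    ⟨hasWeakDeriv_of_weakTendsto (fun n => (h _).hasWeakDeriv) h₁' h₂',
      isPosMul_of_weakTendsto (fun n => (h _).isPosMul) h₁' h₃⟩
  refine ⟨fun n => k₁ (k₂ (k₃ n)), hk₁.comp (hk₂.comp hk₃), u, u', v, hosc, ?_, h₂', h₃⟩
  have := tendsto_zero_of_weakTendsto (f := fun n => f (k₁ (k₂ (k₃ n))) - u)
    (f' := fun n => f' (k₁ (k₂ (k₃ n))) - u') (g := fun n => g (k₁ (k₂ (k₃ n))) - v) (C := C + C)
    (fun n => ⟨(h _).hasWeakDeriv.sub hosc.hasWeakDeriv, (h _).isPosMul.sub hosc.isPosMul⟩)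
    (fun w => by simpa [inner_sub_right] using (h₁' w).sub_const (inner ℂ w u))
    (fun n => (norm_sub_le _ _).trans (add_le_add (hC _) hu))
    (fun n => (norm_sub_le _ _).trans (add_le_add (hC' _) hu'))
    (fun n => (norm_sub_le _ _).trans (add_le_add (hCg _) hv))
  simpa using this.add_const u

/-! ### Commutation relation and oscillator ground state. -/

theorem re_inner_symm (f g : L2) : (inner ℂ f g).re = (inner ℂ g f).re := by
  rw [← inner_conj_symm, Complex.conj_re]

theorem re_inner_add_sub (a b c d : L2) : (inner ℂ (a - b) (c + d)).re
    = (inner ℂ a c).re + (inner ℂ a d).re - (inner ℂ b c).re - (inner ℂ b d).re := by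
  rw [inner_sub_left, inner_add_right, inner_add_right]
  simp only [Complex.sub_re, Complex.add_re]
  ring

/-- The mean position of a translate. -/
theorem re_inner_translate_pos (f g : L2) (a : ℝ) :
    (inner ℂ (translate a f) (translate a g - (a : ℂ) • translate a f)).re
      = (inner ℂ f g).re - a * ‖f‖ ^ 2 := by
  rw [inner_sub_right, inner_smul_right, inner_translate, inner_translate, Complex.sub_re,
    Complex.re_ofReal_mul, re_inner_self]

/-- The mean squared position of a translate. -/
theorem norm_sq_translate_pos (f g : L2) (a : ℝ) :
    ‖translate a g - (a : ℂ) • translate a f‖ ^ 2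
      = ‖g‖ ^ 2 - 2 * a * (inner ℂ f g).re + a ^ 2 * ‖f‖ ^ 2 := by
  have h := norm_sub_sq (𝕜 := ℂ) (translate a g) ((a : ℂ) • translate a f)
  rw [h, inner_smul_right, inner_translate, norm_smul, (translate a).norm_map,
    (translate a).norm_map, RCLike.re_eq_complex_re, Complex.re_ofReal_mul, re_inner_symm,
    Complex.norm_real, mul_pow, Real.norm_eq_abs, sq_abs]
  ring

/-- Translations preserve the norm, so differentiating ‖f(· + s)‖² at s = 0 gives zero. -/
theorem HasWeakDeriv.re_inner_eq_zero {f f' : L2} (h : HasWeakDeriv f f') :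
    (inner ℂ f f').re = 0 := by
  have h1 := ((h.hasDerivAt_translate 0).inner ℂ (h.hasDerivAt_translate 0))
  simp only [translate_zero, inner_translate] at h1
  have h2 := congrArg Complex.re (h1.unique (hasDerivAt_const 0 _))
  rw [Complex.add_re, re_inner_symm f' f, Complex.zero_re] at h2
  linarith

/-- The canonical commutation relation in mean. -/
theorem Oscillator.re_inner {f f' g : L2} (h : Oscillator f f' g) :
    (inner ℂ f' g).re = -(‖f‖ ^ 2) / 2 := by
  set X : ℝ → L2 := fun s => QRabi.translate s g - (s : ℂ) • QRabi.translate s f with hX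
  have hslope := (hasDerivAt_iff_tendsto_slope.mp (h.hasWeakDeriv.hasDerivAt_translate 0))
  have hXc : Continuous X := (continuous_translate g).sub
    (Complex.continuous_ofReal.smul (continuous_translate f))
  have hXt : Tendsto (fun s => X s + g) (𝓝[≠] 0) (𝓝 (X 0 + g)) :=
    ((hXc.add continuous_const).tendsto 0).mono_left nhdsWithin_le_nhds
  have hlim := (Complex.continuous_re.tendsto _).comp
    (Filter.Tendsto.inner (𝕜 := ℂ) hslope hXt)
  -- The product is symmetrized as (f_s − f)(x f_s + x f)/s: the cross terms cancel because x is
  -- symmetric, and what remains is the change of mean position under translation. No derivative of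
  -- x f is needed.
  have hconst : ∀ᶠ s in 𝓝[≠] (0 : ℝ),
      (inner ℂ (slope (fun s => QRabi.translate s f) 0 s) (X s + g)).re = -(‖f‖ ^ 2) := by
    filter_upwards [self_mem_nhdsWithin] with s hs
    have hs' : s ≠ 0 := hs
    rw [slope_def_module, sub_zero, translate_zero, ← algebraMap_smul ℂ s⁻¹,
      Complex.coe_algebraMap, inner_smul_left, Complex.conj_ofReal, Complex.re_ofReal_mul, re_inner_add_sub]
    have hsymm : (inner ℂ f (X s)).re = (inner ℂ (QRabi.translate s f) g).re := by
      rw [re_inner_symm, (h.isPosMul.translate s).inner_comm h.isPosMul]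
    rw [hsymm, re_inner_translate_pos]
    field_simp
    ring
  have huniq := tendsto_nhds_unique hlim
    (tendsto_const_nhds.congr' (hconst.mono fun s hs => hs.symm))
  have hX0 : X 0 = g := by
    simp only [hX, translate_zero, Complex.ofReal_zero]
    rw [zero_smul, sub_zero]
  rw [hX0, translate_zero, ← two_smul ℂ g, inner_smul_right] at huniq
  have : (2 * inner ℂ f' g).re = 2 * (inner ℂ f' g).re := by simp
  rw [this] at huniq
  linarith

/-- Expand ‖f' + ω x f‖² ≥ 0; the commutation relation evaluates the cross term. -/
theorem Oscillator.ground_energy_le {f f' g : L2} (h : Oscillator f f' g) (ω : ℝ) :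
    ω / 2 * ‖f‖ ^ 2 ≤ 1 / 2 * ‖f'‖ ^ 2 + ω ^ 2 / 2 * ‖g‖ ^ 2 := by
  have h0 := norm_add_sq (𝕜 := ℂ) f' ((ω : ℂ) • g)
  have h1 := sq_nonneg ‖f' + (ω : ℂ) • g‖
  rw [h0, inner_smul_right, RCLike.re_eq_complex_re, Complex.re_ofReal_mul, h.re_inner, norm_smul,
    Complex.norm_real, mul_pow, Real.norm_eq_abs, sq_abs] at h1
  linarith

/-- The ground state of the harmonic oscillator. -/
theorem exists_oscillator_ground_state {ω : ℝ} (hω : 0 < ω) :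
    ∃ f f' g : L2, Oscillator f f' g ∧ ‖f‖ = 1 ∧ (inner ℂ f g).re = 0 ∧
      1 / 2 * ‖f'‖ ^ 2 + ω ^ 2 / 2 * ‖g‖ ^ 2 = ω / 2 := by
  set G : ℝ → ℝ := fun x => Real.exp (-(ω / 2) * x ^ 2) with hG
  have hGc : Continuous G := by fun_prop
  have hGd : ∀ x, HasDerivAt G (-(ω * (x * G x))) x := by
    intro x
    have := ((hasDerivAt_pow 2 x).const_mul (-(ω / 2))).exp
    refine this.congr_deriv ?_
    simp only [hG]
    push_cast
    ring
  have hGsq : ∀ x, G x ^ 2 = Real.exp (-ω * x ^ 2) := by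
    intro x
    rw [hG, ← Real.exp_nat_mul]
    congr 1
    push_cast
    ring
  have hm : MemLp (fun x => (G x : ℂ)) 2 volume := by
    refine MemLp.ofReal (K := ℂ) ((memLp_two_iff_integrable_sq hGc.aestronglyMeasurable).mpr ?_)
    simp only [hGsq]
    exact integrable_exp_neg_mul_sq hω
  have hxm : MemLp (fun x => ((x * G x : ℝ) : ℂ)) 2 volume := by
    refine MemLp.ofReal (K := ℂ)
      ((memLp_two_iff_integrable_sq (continuous_id.mul hGc).aestronglyMeasurable).mpr ?_)
    simp only [Pi.mul_apply, mul_pow, hGsq, id]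
    have := integrable_rpow_mul_exp_neg_mul_sq hω (s := 2) (by norm_num)
    simpa using this
  set f := hm.toLp _ with hf
  set g := hxm.toLp _ with hg
  have hfg : IsPosMul f g := by
    filter_upwards [hm.coeFn_toLp, hxm.coeFn_toLp] with x h1 h2
    rw [h1, h2]
    simp
  have hfd : HasWeakDeriv f ((-ω : ℂ) • g) := by
    intro η hη hc
    have e1 : ∫ x, deriv η x • f x = ∫ x, (((deriv η x) * G x : ℝ) : ℂ) := by
      apply integral_congr_ae
      filter_upwards [hm.coeFn_toLp] with x h1
      rw [h1]
      simp
    have e2 : ∫ x, η x • ((-ω : ℂ) • g) x = ∫ x, ((η x * (-(ω * (x * G x))) : ℝ) : ℂ) := by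
      apply integral_congr_ae
      filter_upwards [hxm.coeFn_toLp, Lp.coeFn_smul (-ω : ℂ) g] with x h1 h2
      rw [h2, Pi.smul_apply, h1]
      simp
    have hd : Continuous (deriv η) := hη.continuous_deriv (by norm_cast)
    have hparts := integral_mul_deriv_eq_deriv_mul_of_integrable (u := η) (v := G)
      (u' := deriv η) (v' := fun x => -(ω * (x * G x)))
      (fun x _ => (hη.differentiable (by simp) x).hasDerivAt) (fun x _ => hGd x)
      ((hη.continuous.mul (by fun_prop)).integrable_of_hasCompactSupport hc.mul_right)
      ((hd.mul hGc).integrable_of_hasCompactSupport hc.deriv.mul_right)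
      ((hη.continuous.mul hGc).integrable_of_hasCompactSupport hc.mul_right)
    rw [e1, e2, integral_complex_ofReal, integral_complex_ofReal, hparts]
    simp
  have hf0 : ‖f‖ ≠ 0 := by
    intro h0
    have hz : ∀ᵐ x : ℝ, G x = 0 := by
      filter_upwards [hm.coeFn_toLp, Lp.eq_zero_iff_ae_eq_zero.mp (norm_eq_zero.mp h0)] with x h1 h2
      rw [h1] at h2
      exact Complex.ofReal_eq_zero.mp h2
    obtain ⟨x, hx⟩ := hz.exists
    exact (Real.exp_pos _).ne' hx
  set c : ℂ := ((‖f‖⁻¹ : ℝ) : ℂ) with hc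
  have hosc : Oscillator (c • f) (c • ((-ω : ℂ) • g)) (c • g) :=
    (Oscillator.mk hfd hfg).smul c
  have hnorm : ‖c • f‖ = 1 := by
    rw [norm_smul, hc, Complex.norm_real, norm_inv, norm_norm, inv_mul_cancel₀ hf0]
  refine ⟨_, _, _, hosc, hnorm, ?_, ?_⟩
  -- For the Gaussian f' = −ω x f, so Re⟨f, f'⟩ = 0 says that the state is centred; likewise the
  -- commutation relation below gives ‖x f‖² = 1/(2ω).
  · have h1 := hosc.hasWeakDeriv.re_inner_eq_zero
    rw [smul_comm c, inner_smul_right, ← Complex.ofReal_neg, Complex.re_ofReal_mul] at h1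
    exact (mul_eq_zero.mp h1).resolve_left (by linarith)
  · have h1 := hosc.re_inner
    rw [smul_comm c, ← Complex.ofReal_neg, inner_smul_left, Complex.conj_ofReal,
      Complex.re_ofReal_mul, hnorm, re_inner_self] at h1
    rw [smul_comm c, norm_smul, mul_pow, norm_neg, Complex.norm_real, Real.norm_eq_abs, sq_abs]
    nlinarith

/-! ### Expectation values as inner products, and their behaviour under shifts. -/

theorem L2.integrable_mul_norm_sq {f g : L2} (h : IsPosMul f g) :
    Integrable (fun x : ℝ => x * ‖f x‖ ^ 2) volume ∧
      ∫ x : ℝ, x * ‖f x‖ ^ 2 = (inner ℂ f g).re := by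
  have e : ∀ᵐ x : ℝ, RCLike.re (inner ℂ (f x) (g x)) = x * ‖f x‖ ^ 2 := by
    filter_upwards [h] with x hx
    rw [hx, RCLike.inner_apply, smul_mul_assoc, Complex.mul_conj', RCLike.re_eq_complex_re,
      Complex.smul_re, ← Complex.ofReal_pow, Complex.ofReal_re, smul_eq_mul]
  refine ⟨((L2.integrable_inner f g).re).congr e, ?_⟩
  rw [L2.inner_def, ← RCLike.re_eq_complex_re, ← integral_re (L2.integrable_inner f g)]
  exact (integral_congr_ae e).symm

theorem L2.integrable_sq_mul_norm_sq {f g : L2} (h : IsPosMul f g) :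
    Integrable (fun x : ℝ => x ^ 2 * ‖f x‖ ^ 2) volume ∧
      ∫ x : ℝ, x ^ 2 * ‖f x‖ ^ 2 = ‖g‖ ^ 2 := by
  have e : ∀ᵐ x : ℝ, ‖g x‖ ^ 2 = x ^ 2 * ‖f x‖ ^ 2 := by
    filter_upwards [h] with x hx
    rw [hx, norm_smul, mul_pow, Real.norm_eq_abs, sq_abs]
  refine ⟨(L2.integrable_norm_sq g).congr e, ?_⟩
  rw [L2.norm_sq_eq_integral]
  exact (integral_congr_ae e).symm

section Expectations

variable {ψ : State} {f' g' xf xg : L2}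

theorem expSigmaZX_eq (hf : Oscillator ψ.fst f' xf) (hg : Oscillator ψ.snd g' xg) :
    expSigmaZX ψ = (inner ℂ ψ.fst xf).re - (inner ℂ ψ.snd xg).re := by
  obtain ⟨i3, e3⟩ := L2.integrable_mul_norm_sq hf.isPosMul
  obtain ⟨i4, e4⟩ := L2.integrable_mul_norm_sq hg.isPosMul
  simp only [expSigmaZX, mul_sub]
  rw [integral_sub i3 i4, e3, e4]

theorem energy_eq (hf : Oscillator ψ.fst f' xf) (hg : Oscillator ψ.snd g' xg) (ω t g lam : ℝ) :
    energy ω t g lam ψ = 1 / 2 * (‖f'‖ ^ 2 + ‖g'‖ ^ 2) + ω ^ 2 / 2 * (‖xf‖ ^ 2 + ‖xg‖ ^ 2)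
      - 2 * t * (inner ℂ ψ.fst ψ.snd).re
      + lam * g * ((inner ℂ ψ.fst xf).re - (inner ℂ ψ.snd xg).re) := by
  have h1 : expP2 ψ = ‖f'‖ ^ 2 + ‖g'‖ ^ 2 := by
    rw [expP2, hf.hasWeakDeriv.weakDeriv_eq, hg.hasWeakDeriv.weakDeriv_eq,
      integral_add (L2.integrable_norm_sq _) (L2.integrable_norm_sq _), L2.norm_sq_eq_integral,
      L2.norm_sq_eq_integral]
  obtain ⟨i1, e1⟩ := L2.integrable_sq_mul_norm_sq hf.isPosMul
  obtain ⟨i2, e2⟩ := L2.integrable_sq_mul_norm_sq hg.isPosMul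
  have h2 : expX2 ψ = ‖xf‖ ^ 2 + ‖xg‖ ^ 2 := by
    simp only [expX2, mul_add]
    rw [integral_add i1 i2, e1, e2]
  have h4 : expSigmaX ψ = 2 * (inner ℂ ψ.fst ψ.snd).re := by
    rw [expSigmaX, L2.inner_def]
    simp only [RCLike.inner_apply, mul_comm]
  rw [energy, h1, h2, expSigmaZX_eq hf hg, h4]
  ring

theorem displacement_eq (hf : Oscillator ψ.fst f' xf) (hg : Oscillator ψ.snd g' xg) :
    displacement ψ = (inner ℂ ψ.fst xf).re + (inner ℂ ψ.snd xg).re := by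
  obtain ⟨i3, e3⟩ := L2.integrable_mul_norm_sq hf.isPosMul
  obtain ⟨i4, e4⟩ := L2.integrable_mul_norm_sq hg.isPosMul
  simp only [displacement, mul_add]
  rw [integral_add i3 i4, e3, e4]

theorem mem_constraintSet_iff (hf : Oscillator ψ.fst f' xf) (hg : Oscillator ψ.snd g' xg)
    {σ ξ : ℝ} : ψ ∈ constraintSet σ ξ ↔ ‖ψ.fst‖ ^ 2 = (1 + σ) / 2 ∧ ‖ψ.snd‖ ^ 2 = (1 - σ) / 2 ∧
      (inner ℂ ψ.fst xf).re + (inner ℂ ψ.snd xg).re = ξ := by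
  have hn : ‖ψ‖ = 1 ↔ ‖ψ.fst‖ ^ 2 + ‖ψ.snd‖ ^ 2 = 1 := by
    rw [← WithLp.prod_norm_sq_eq_of_L2, pow_eq_one_iff_of_nonneg (norm_nonneg ψ) two_ne_zero]
  have hQ : ψ ∈ Q₀ := ⟨hf.finiteEnergy, hg.finiteEnergy⟩
  rw [constraintSet, Set.mem_ofPred_eq, hn, displacement_eq hf hg, polarization]
  constructor
  · rintro ⟨-, h1, h2, h3⟩
    exact ⟨by linarith, by linarith, h3⟩
  · rintro ⟨h1, h2, h3⟩
    exact ⟨hQ, by linarith, by linarith, h3⟩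

end Expectations

/-- The state whose components are those of `ψ` translated by `a` and by `b`. -/
noncomputable def shift (a b : ℝ) (ψ : State) : State :=
  WithLp.toLp 2 (translate a ψ.fst, translate b ψ.snd)

theorem energy_shift {ψ : State} {f' g' xf xg : L2} (hf : Oscillator ψ.fst f' xf)
    (hg : Oscillator ψ.snd g' xg) (ω t g lam a b : ℝ) :
    energy ω t g lam (shift a b ψ) = energy ω t g lam ψ
      + ω ^ 2 / 2 * (-2 * a * (inner ℂ ψ.fst xf).re + a ^ 2 * ‖ψ.fst‖ ^ 2
        - 2 * b * (inner ℂ ψ.snd xg).re + b ^ 2 * ‖ψ.snd‖ ^ 2)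
      - 2 * t * ((inner ℂ (translate a ψ.fst) (translate b ψ.snd)).re
        - (inner ℂ ψ.fst ψ.snd).re)
      + lam * g * (-a * ‖ψ.fst‖ ^ 2 + b * ‖ψ.snd‖ ^ 2) := by
  rw [energy_eq hf hg, energy_eq (ψ := shift a b ψ) (hf.translate a) (hg.translate b)]
  simp only [shift, WithLp.toLp_fst, WithLp.toLp_snd, norm_sq_translate_pos,
    re_inner_translate_pos, LinearIsometry.norm_map]
  ring

theorem shift_mem_constraintSet {ψ : State} {f' g' xf xg : L2} (hf : Oscillator ψ.fst f' xf)
    (hg : Oscillator ψ.snd g' xg) {σ ξ : ℝ} (h : ψ ∈ constraintSet σ ξ) (a b : ℝ) :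
    shift a b ψ ∈ constraintSet σ (ξ - a * ((1 + σ) / 2) - b * ((1 - σ) / 2)) := by
  rw [mem_constraintSet_iff (ψ := shift a b ψ) (hf.translate a) (hg.translate b)]
  obtain ⟨h1, h2, h3⟩ := (mem_constraintSet_iff hf hg).mp h
  simp only [shift, WithLp.toLp_fst, WithLp.toLp_snd, re_inner_translate_pos,
    LinearIsometry.norm_map]
  refine ⟨h1, h2, ?_⟩
  rw [h1, h2]
  linarith

theorem exists_oscillators {ψ : State} {σ ξ : ℝ} (h : ψ ∈ constraintSet σ ξ) :
    ∃ f' g' xf xg, Oscillator ψ.fst f' xf ∧ Oscillator ψ.snd g' xg := by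
  obtain ⟨f', xf, hf⟩ := h.1.1.exists_oscillator
  obtain ⟨g', xg, hg⟩ := h.1.2.exists_oscillator
  exact ⟨f', g', xf, xg, hf, hg⟩

/-- Translation of both components by the same amount. -/
theorem shift_self_mem_and_energy_eq {ψ : State} {σ ξ : ℝ} (h : ψ ∈ constraintSet σ ξ) (ω t g lam a : ℝ) :
    shift a a ψ ∈ constraintSet σ (ξ - a) ∧ energy ω t g lam (shift a a ψ)
      = energy ω t g lam ψ + ω ^ 2 / 2 * (a ^ 2 - 2 * a * ξ) - lam * g * a * σ := by
  obtain ⟨f', g', xf, xg, hf, hg⟩ := exists_oscillators h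
  obtain ⟨h1, h2, h3⟩ := (mem_constraintSet_iff hf hg).mp h
  refine ⟨?_, ?_⟩
  · have := shift_mem_constraintSet hf hg h a a
    rwa [show ξ - a * ((1 + σ) / 2) - a * ((1 - σ) / 2) = ξ - a by ring] at this
  · rw [energy_shift hf hg, inner_translate, h1, h2, ← h3]
    ring

/-- Joint translation is a bijection between the constraint sets at 0 and ξ, and shifts the energy
by a constant on each. -/
theorem IsOptimizer.isLeast_translate {ω t g lam σ : ℝ} {φ : State}
    (h : IsOptimizer ω t g lam σ 0 φ) (ξ : ℝ) :
    IsLeast (energy ω t g lam '' constraintSet σ ξ)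
      (energy ω t g lam φ + ω ^ 2 / 2 * ξ ^ 2 + lam * g * σ * ξ) := by
  constructor
  · obtain ⟨h1, h2⟩ := shift_self_mem_and_energy_eq h.1 ω t g lam (-ξ)
    rw [zero_sub, neg_neg] at h1
    refine ⟨_, h1, ?_⟩
    rw [h2]
    ring
  · rintro _ ⟨χ, hχ, rfl⟩
    obtain ⟨h1, h2⟩ := shift_self_mem_and_energy_eq hχ ω t g lam ξ
    rw [sub_self] at h1
    have := h.2 _ h1
    rw [h2] at this
    linarith

/-! ### Existence of optimizers. -/

/-- Coercivity: half of the potential energy absorbs the coupling term by Young's inequality, once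
per component, and the overlap costs at most 2t. -/
theorem energy_lower_bound {ψ : State} {f' g' xf xg : L2} (hf : Oscillator ψ.fst f' xf)
    (hg : Oscillator ψ.snd g' xg) {σ ξ : ℝ} (h : ψ ∈ constraintSet σ ξ) {ω t : ℝ} (hω : 0 < ω)
    (ht : 0 < t) (g lam : ℝ) :
    1 / 2 * (‖f'‖ ^ 2 + ‖g'‖ ^ 2) + ω ^ 2 / 4 * (‖xf‖ ^ 2 + ‖xg‖ ^ 2)
      - (2 * t + 2 * (lam * g) ^ 2 / ω ^ 2) ≤ energy ω t g lam ψ := by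
  obtain ⟨h1, h2, h3⟩ := (mem_constraintSet_iff hf hg).mp h
  have n1 := norm_nonneg ψ.fst
  have n2 := norm_nonneg ψ.snd
  have b1 : ‖ψ.fst‖ ≤ 1 := by nlinarith
  have b2 : ‖ψ.snd‖ ≤ 1 := by nlinarith
  have hb : ∀ (u v : L2), ‖u‖ ≤ 1 → |(inner ℂ u v).re| ≤ ‖v‖ := fun u v hu =>
    (Complex.abs_re_le_norm _).trans ((norm_inner_le_norm u v).trans
      (mul_le_of_le_one_left (norm_nonneg v) hu))
  have hK : ∀ (K m y : ℝ), |m| ≤ y → -(ω ^ 2 / 4 * y ^ 2 + K ^ 2 / ω ^ 2) ≤ K * m := by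
    intro K m y hm
    have hy : 0 ≤ y := (abs_nonneg m).trans hm
    have k1 : -(|K| * y) ≤ K * m := by
      have := neg_abs_le (K * m)
      rw [abs_mul] at this
      have := mul_le_mul_of_nonneg_left hm (abs_nonneg K)
      linarith
    have k2 : |K| * y ≤ ω ^ 2 / 4 * y ^ 2 + K ^ 2 / ω ^ 2 := by
      have := sq_nonneg (ω / 2 * y - |K| / ω)
      have e : (ω / 2 * y - |K| / ω) ^ 2 = ω ^ 2 / 4 * y ^ 2 + K ^ 2 / ω ^ 2 - |K| * y := by
        rw [sub_sq, div_pow |K|, sq_abs]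
        field_simp
        ring
      linarith
    linarith
  have c1 := hK (lam * g) _ _ (hb ψ.fst xf b1)
  have c2 := hK (-(lam * g)) _ _ (hb ψ.snd xg b2)
  have c3 := (le_abs_self _).trans ((hb ψ.fst ψ.snd b1).trans b2)
  rw [energy_eq hf hg]
  have c4 := mul_le_mul_of_nonneg_left c3 ht.le
  rw [neg_sq] at c2
  have e : 2 * (lam * g) ^ 2 / ω ^ 2 = (lam * g) ^ 2 / ω ^ 2 + (lam * g) ^ 2 / ω ^ 2 := by ring
  rw [e]
  linarith

/-- The product of the two component norms. -/
theorem two_mul_norm_mul_norm {ψ : State} {σ : ℝ} (h1 : ‖ψ.fst‖ ^ 2 = (1 + σ) / 2)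
    (h2 : ‖ψ.snd‖ ^ 2 = (1 - σ) / 2) : 2 * (‖ψ.fst‖ * ‖ψ.snd‖) = √(1 - σ ^ 2) := by
  rw [show 1 - σ ^ 2 = (2 * (‖ψ.fst‖ * ‖ψ.snd‖)) ^ 2 by rw [mul_pow, mul_pow, h1, h2]; ring,
    Real.sqrt_sq (by positivity)]

/-- Both components are multiples √((1 ± σ)/2) of the same centred oscillator ground state, so the
coupling term vanishes for every coupling. -/
theorem exists_mem_constraintSet {ω : ℝ} (hω : 0 < ω) {σ : ℝ} (hσ : σ ∈ Set.Icc (-1 : ℝ) 1)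
    (t g lam : ℝ) : ∃ ψ ∈ constraintSet σ 0,
      energy ω t g lam ψ = ω / 2 - t * √(1 - σ ^ 2) := by
  obtain ⟨u, u', v, hu, hn, hm, he⟩ := exists_oscillator_ground_state hω
  obtain ⟨hl, hr⟩ := hσ
  have hp : 0 ≤ (1 + σ) / 2 := by linarith
  have hq : 0 ≤ (1 - σ) / 2 := by linarith
  set ψ : State := WithLp.toLp 2 (((√((1 + σ) / 2) : ℝ) : ℂ) • u, ((√((1 - σ) / 2) : ℝ) : ℂ) • u)
    with hψ
  have hf : Oscillator ψ.fst _ _ := hu.smul _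
  have hg : Oscillator ψ.snd _ _ := hu.smul _
  have hns : ∀ (c : ℝ) (w : L2), 0 ≤ c → ‖((√c : ℝ) : ℂ) • w‖ ^ 2 = c * ‖w‖ ^ 2 := by
    intro c w hc
    rw [norm_smul, mul_pow, Complex.norm_real, Real.norm_eq_abs, sq_abs, Real.sq_sqrt hc]
  have hin : ∀ c d : ℝ, ∀ w z : L2, (inner ℂ ((c : ℂ) • w) ((d : ℂ) • z)).re
      = c * d * (inner ℂ w z).re := by
    intro c d w z
    rw [inner_smul_left, inner_smul_right, Complex.conj_ofReal, Complex.re_ofReal_mul,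
      Complex.re_ofReal_mul, mul_assoc]
  refine ⟨ψ, (mem_constraintSet_iff hf hg).mpr ⟨?_, ?_, ?_⟩, ?_⟩
  · simp only [hψ, WithLp.toLp_fst, hns _ _ hp, hn]
    ring
  · simp only [hψ, WithLp.toLp_snd, hns _ _ hq, hn]
    ring
  · simp only [hψ, WithLp.toLp_fst, WithLp.toLp_snd, hin, hm]
    ring
  · rw [energy_eq hf hg]
    simp only [hψ, WithLp.toLp_fst, WithLp.toLp_snd, hin, hm, hns _ _ hp, hns _ _ hq,
      re_inner_self, hn]
    have : √(1 - σ ^ 2) = 2 * (√((1 + σ) / 2) * √((1 - σ) / 2)) := by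
      rw [← Real.sqrt_mul hp, show (1 - σ ^ 2) = 2 ^ 2 * ((1 + σ) / 2 * ((1 - σ) / 2)) by ring,
        Real.sqrt_mul (by positivity), Real.sqrt_sq two_pos.le]
    rw [this]
    linear_combination he

/-- Direct method. Along a minimizing subsequence the components converge strongly, while
derivatives and position vectors converge only weakly. Strong against weak suffices for the
constraints, the overlap and the coupling term; the kinetic and potential terms are lower
semicontinuous. -/
theorem exists_isOptimizer {ω t : ℝ} (hω : 0 < ω) (ht : 0 < t) {σ : ℝ}
    (hσ : σ ∈ Set.Icc (-1 : ℝ) 1) (g lam : ℝ) : ∃ φ, IsOptimizer ω t g lam σ 0 φ := by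
  set D : ℝ := 2 * t + 2 * (lam * g) ^ 2 / ω ^ 2 with hD
  have hne : (energy ω t g lam '' constraintSet σ 0).Nonempty := by
    obtain ⟨ψ, hψ, -⟩ := exists_mem_constraintSet hω hσ t g lam
    exact ⟨_, ψ, hψ, rfl⟩
  have hbdd : BddBelow (energy ω t g lam '' constraintSet σ 0) := by
    refine ⟨-D, ?_⟩
    rintro _ ⟨ψ, hψ, rfl⟩
    obtain ⟨f', g', xf, xg, hf, hg⟩ := exists_oscillators hψ
    have := energy_lower_bound hf hg hψ hω ht g lam
    have : 0 ≤ 1 / 2 * (‖f'‖ ^ 2 + ‖g'‖ ^ 2) + ω ^ 2 / 4 * (‖xf‖ ^ 2 + ‖xg‖ ^ 2) := by positivity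
    linarith
  obtain ⟨e, hanti, hlim, hmem⟩ := exists_seq_tendsto_sInf hne hbdd
  choose ψ hψ hψe using hmem
  choose f' g' xf xg hf hg using fun n => exists_oscillators (hψ n)
  set M : ℝ := e 0 + D with hM
  have hbound : ∀ n, 1 / 2 * (‖f' n‖ ^ 2 + ‖g' n‖ ^ 2)
      + ω ^ 2 / 4 * (‖xf n‖ ^ 2 + ‖xg n‖ ^ 2) ≤ M := by
    intro n
    have h1 := energy_lower_bound (hf n) (hg n) (hψ n) hω ht g lam
    have h2 := hanti (Nat.zero_le n)
    rw [hψe] at h1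
    linarith
  set C : ℝ := 1 + √(2 * M) + √(4 * M / ω ^ 2) with hC
  have hs1 := Real.sqrt_nonneg (2 * M)
  have hs2 := Real.sqrt_nonneg (4 * M / ω ^ 2)
  have hω2 : 0 < ω ^ 2 := by positivity
  have hP : ∀ y : ℝ, 1 / 2 * y ^ 2 ≤ M → y ≤ C := by
    intro y hy
    have := Real.le_sqrt_of_sq_le (x := y) (y := 2 * M) (by linarith)
    linarith
  have hX : ∀ y : ℝ, ω ^ 2 / 4 * y ^ 2 ≤ M → y ≤ C := by
    intro y hy
    have := Real.le_sqrt_of_sq_le (x := y) (y := 4 * M / ω ^ 2)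
      (by rw [le_div_iff₀ hω2]; linarith)
    linarith
  have hcon := fun n => (mem_constraintSet_iff (hf n) (hg n)).mp (hψ n)
  have hN : ∀ y : ℝ, y ^ 2 ≤ 1 → y ≤ C := fun y hy => by nlinarith
  have q : ∀ n, 0 ≤ 1 / 2 * ‖f' n‖ ^ 2 ∧ 0 ≤ 1 / 2 * ‖g' n‖ ^ 2 ∧ 0 ≤ ω ^ 2 / 4 * ‖xf n‖ ^ 2 ∧
      0 ≤ ω ^ 2 / 4 * ‖xg n‖ ^ 2 := fun n => ⟨by positivity, by positivity, by positivity,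
    by positivity⟩
  have bf' : ∀ n, ‖f' n‖ ≤ C := fun n => hP _ (by linarith [hbound n, q n])
  have bg' : ∀ n, ‖g' n‖ ≤ C := fun n => hP _ (by linarith [hbound n, q n])
  have bxf : ∀ n, ‖xf n‖ ≤ C := fun n => hX _ (by linarith [hbound n, q n])
  have bxg : ∀ n, ‖xg n‖ ≤ C := fun n => hX _ (by linarith [hbound n, q n])
  obtain ⟨k, hk, u, u', xu, hu, lu, lu', lxu⟩ := exists_subseq_of_oscillator hf
    (fun n => hN _ (by linarith [(hcon n).1, hσ.2])) bf' bxf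
  obtain ⟨j, hj, v, v', xv, hv, lv, lv', lxv⟩ := exists_subseq_of_oscillator (fun n => hg (k n))
    (fun n => hN _ (by linarith [(hcon (k n)).2.1, hσ.1])) (fun n => bg' _) (fun n => bxg _)
  replace lu := lu.comp hj.tendsto_atTop
  replace lu' := lu'.comp hj
  replace lxu := lxu.comp hj
  have lm1 := (Complex.continuous_re.tendsto _).comp
    (tendsto_inner_of_tendsto_of_weakTendsto lu lxu (fun n => bxf _))
  have lm2 := (Complex.continuous_re.tendsto _).comp
    (tendsto_inner_of_tendsto_of_weakTendsto lv lxv (fun n => bxg _))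
  have lin := (Complex.continuous_re.tendsto _).comp (lu.inner (𝕜 := ℂ) lv)
  have lnu := (lu.norm).pow 2
  have lnv := (lv.norm).pow 2
  set φ : State := WithLp.toLp 2 (u, v) with hφ
  have hφf : Oscillator φ.fst u' xu := hu
  have hφg : Oscillator φ.snd v' xv := hv
  have hφmem : φ ∈ constraintSet σ 0 := by
    rw [mem_constraintSet_iff hφf hφg]
    refine ⟨tendsto_nhds_unique lnu (tendsto_const_nhds.congr fun n => ((hcon _).1).symm),
      tendsto_nhds_unique lnv (tendsto_const_nhds.congr fun n => ((hcon _).2.1).symm),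
      tendsto_nhds_unique (lm1.add lm2) (tendsto_const_nhds.congr fun n => ((hcon _).2.2).symm)⟩
  have lw : ∀ {w : ℕ → L2} {w₀ : L2}, WeakTendsto w w₀ →
      Tendsto (fun n => 2 * (inner ℂ w₀ (w n)).re - ‖w₀‖ ^ 2) atTop (𝓝 (‖w₀‖ ^ 2)) := by
    intro w w₀ hw
    have := (((Complex.continuous_re.tendsto _).comp (hw w₀)).const_mul 2).sub_const (‖w₀‖ ^ 2)
    rwa [re_inner_self, two_mul, add_sub_cancel_right] at this
  -- The energy with each squared norm replaced by its tangent at the limit: it lies below the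
  -- energy of the sequence and converges to the energy of the limit.
  have llow := ((((lw lu').add (lw lv')).const_mul (1 / 2)).add
    (((lw lxu).add (lw lxv)).const_mul (ω ^ 2 / 2))).sub (lin.const_mul (2 * t)) |>.add
    ((lm1.sub lm2).const_mul (lam * g))
  have hle : energy ω t g lam φ ≤ sInf (energy ω t g lam '' constraintSet σ 0) := by
    rw [energy_eq hφf hφg]
    refine le_of_tendsto_of_tendsto' llow
      (hlim.comp (hk.tendsto_atTop.comp hj.tendsto_atTop)) fun n => ?_
    simp only [Function.comp_apply]
    rw [← hψe, energy_eq (hf _) (hg _)]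
    have hh : 0 ≤ ω ^ 2 / 2 := by positivity
    gcongr <;> exact two_re_inner_sub_le_norm_sq _ _
  exact ⟨φ, hφmem, fun χ hχ => hle.trans (csInf_le hbdd ⟨χ, hχ, rfl⟩)⟩

/-- Absolute values keep all position moments and norms, do not increase the kinetic energy, and do
not decrease the overlap, which enters with the negative sign −2t. -/
theorem IsOptimizer.exists_isNonneg {ω t g lam σ ξ : ℝ} (ht : 0 < t) {φ : State}
    (h : IsOptimizer ω t g lam σ ξ φ) : ∃ χ, IsOptimizer ω t g lam σ ξ χ ∧ IsNonneg χ := by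
  obtain ⟨f', g', xf, xg, hf, hg⟩ := exists_oscillators h.1
  obtain ⟨h1, h2, h3⟩ := (mem_constraintSet_iff hf hg).mp h.1
  obtain ⟨u', hu', nu'⟩ := hf.hasWeakDeriv.exists_absL2
  obtain ⟨v', hv', nv'⟩ := hg.hasWeakDeriv.exists_absL2
  obtain ⟨xu, hxu, nxu, ixu⟩ := hf.isPosMul.exists_absL2
  obtain ⟨xv, hxv, nxv, ixv⟩ := hg.isPosMul.exists_absL2
  set χ : State := WithLp.toLp 2 (absL2 φ.fst, absL2 φ.snd) with hχ
  have hχf : Oscillator χ.fst u' xu := ⟨hu', hxu⟩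
  have hχg : Oscillator χ.snd v' xv := ⟨hv', hxv⟩
  have hmem : χ ∈ constraintSet σ ξ := by
    rw [mem_constraintSet_iff hχf hχg]
    simp only [hχ, WithLp.toLp_fst, WithLp.toLp_snd, norm_absL2, ixu, ixv]
    exact ⟨h1, h2, h3⟩
  refine ⟨χ, ⟨hmem, fun ρ hρ => le_trans ?_ (h.2 ρ hρ)⟩, ?_⟩
  · rw [energy_eq hχf hχg, energy_eq hf hg]
    simp only [hχ, WithLp.toLp_fst, WithLp.toLp_snd, nxu, nxv, ixu, ixv]
    have := re_inner_le_re_inner_absL2 φ.fst φ.snd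
    gcongr
  · filter_upwards [coeFn_absL2 φ.fst, coeFn_absL2 φ.snd] with x h1 h2
    simp only [hχ, WithLp.toLp_fst, WithLp.toLp_snd, h1, h2, Complex.ofReal_im,
      Complex.ofReal_re, norm_nonneg, and_self]

/-! ### Stationarity and vanishing coupling. -/

theorem energy_eq_add (ω t g μ ν : ℝ) (ψ : State) :
    energy ω t g μ ψ = energy ω t g ν ψ + (μ - ν) * (g * expSigmaZX ψ) := by
  rw [energy, energy]
  ring

theorem hopping_eq {ψ : State} {f' : L2} (hf : HasWeakDeriv ψ.fst f') (hψ : IsRealValued ψ) :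
    hopping ψ = (inner ℂ f' ψ.snd).re := by
  have hi : Integrable (fun x => f' x * ψ.snd x) volume :=
    (Lp.memLp f').integrable_mul (Lp.memLp ψ.snd)
  rw [hopping, hf.weakDeriv_eq, L2.inner_def, ← RCLike.re_eq_complex_re, ← integral_re hi,
    ← integral_re (L2.integrable_inner f' ψ.snd)]
  apply integral_congr_ae
  filter_upwards [hψ] with x hx
  simp [RCLike.inner_apply, hx.2, mul_comm]

/-- Stationarity of an optimizer under opposite translations of its components. -/
theorem IsOptimizer.expSigmaZX_eq {ω t g ν σ : ℝ} (hω : 0 < ω) {φ : State}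
    (h : IsOptimizer ω t g ν σ 0 φ) (hφ : IsRealValued φ) :
    expSigmaZX φ = -(4 * t / ω ^ 2) * hopping φ - ν * g / ω ^ 2 * (1 - σ ^ 2) := by
  obtain ⟨f', g', xf, xg, hf, hg⟩ := exists_oscillators h.1
  obtain ⟨h1, h2, h3⟩ := (mem_constraintSet_iff hf hg).mp h.1
  set m := (inner ℂ φ.fst xf).re with hm
  have hm' : (inner ℂ φ.snd xg).re = -m := by linarith
  set Γ : ℝ → ℝ := fun s => (inner ℂ (translate s φ.fst) φ.snd).re with hΓ
  have hΓ0 : Γ 0 = (inner ℂ φ.fst φ.snd).re := by rw [hΓ]; simp only [translate_zero]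
  have hΓd : HasDerivAt Γ (hopping φ) 0 := by
    have h4 := (hf.hasWeakDeriv.hasDerivAt_translate 0).inner ℂ (hasDerivAt_const 0 φ.snd)
    rw [inner_zero_right, zero_add, translate_zero] at h4
    rw [hopping_eq hf.hasWeakDeriv hφ]
    exact (Complex.reCLM.hasFDerivAt.comp_hasDerivAt (0 : ℝ) h4)
  set p := (1 + σ) / 2 with hp
  set q := (1 - σ) / 2 with hq
  -- With p and q the weights of the two components, shifts by q s and −p s leave the total
  -- displacement unchanged. As p + q = 1, the relative shift is exactly s, so the overlap becomes
  -- `Γ s`.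
  have hE : ∀ s, energy ω t g ν (shift (q * s) (-p * s) φ) = energy ω t g ν φ
      + ω ^ 2 / 2 * (-2 * m * s + p * q * s ^ 2) - 2 * t * (Γ s - Γ 0)
      - 2 * (ν * g) * (p * q) * s := by
    intro s
    have hin : inner ℂ (translate (q * s) φ.fst) (translate (-p * s) φ.snd)
        = inner ℂ (translate s φ.fst) φ.snd := by
      rw [← inner_translate (p * s) (translate (q * s) φ.fst), translate_translate,
        translate_translate, show p * s + -p * s = 0 by ring, translate_zero,
        show p * s + q * s = s by rw [hp, hq]; ring]
    rw [energy_shift hf hg, hin, hΓ0, hm', h1, h2, ← hm]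
    have hpq : p + q = 1 := by rw [hp, hq]; ring
    have hq' : q = 1 - p := by linarith
    rw [hq']
    ring
  have hmin : ∀ s, 0 ≤ ω ^ 2 / 2 * (-2 * m * s + p * q * s ^ 2) - 2 * t * (Γ s - Γ 0)
      - 2 * (ν * g) * (p * q) * s := by
    intro s
    have hmem := shift_mem_constraintSet hf hg h.1 (q * s) (-p * s)
    rw [show 0 - q * s * ((1 + σ) / 2) - -p * s * ((1 - σ) / 2) = 0 by rw [hp, hq]; ring] at hmem
    have := h.2 _ hmem
    rw [hE] at this
    linarith
  have hd : HasDerivAt (fun s => ω ^ 2 / 2 * (-2 * m * s + p * q * s ^ 2) - 2 * t * (Γ s - Γ 0)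
      - 2 * (ν * g) * (p * q) * s)
      (ω ^ 2 / 2 * (-2 * m) - 2 * t * hopping φ - 2 * (ν * g) * (p * q)) 0 := by
    have d1 := (((hasDerivAt_id (0 : ℝ)).const_mul (-2 * m)).add
      ((hasDerivAt_pow 2 (0 : ℝ)).const_mul (p * q))).const_mul (ω ^ 2 / 2)
    have d2 := (hΓd.sub_const (Γ 0)).const_mul (2 * t)
    have d3 := (hasDerivAt_id (0 : ℝ)).const_mul (2 * (ν * g) * (p * q))
    refine ((d1.sub d2).sub d3).congr_deriv ?_
    simp
  have hloc : IsLocalMin (fun s => ω ^ 2 / 2 * (-2 * m * s + p * q * s ^ 2)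
      - 2 * t * (Γ s - Γ 0) - 2 * (ν * g) * (p * q) * s) 0 := by
    refine Eventually.of_forall fun s => ?_
    have := hmin s
    simpa using this
  have h0 := hloc.hasDerivAt_eq_zero hd
  rw [QRabi.expSigmaZX_eq hf hg, hm', ← hm]
  have hσ2 : 1 - σ ^ 2 = 4 * (p * q) := by rw [hp, hq]; ring
  rw [hσ2]
  have hω2 : ω ^ 2 ≠ 0 := by positivity
  field_simp
  linarith

/-- At vanishing coupling the energy is explicit and the mean dipole moment vanishes. -/
theorem IsOptimizer.energy_eq_of_coupling_eq_zero {ω t g ν σ : ℝ} (hω : 0 < ω) (ht : 0 < t)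
    (hσ : σ ∈ Set.Icc (-1 : ℝ) 1) (hνg : ν * g = 0) {φ : State} (h : IsOptimizer ω t g ν σ 0 φ) :
    energy ω t g ν φ = ω / 2 - t * √(1 - σ ^ 2) ∧ expSigmaZX φ = 0 := by
  obtain ⟨f', g', xf, xg, hf, hg⟩ := exists_oscillators h.1
  obtain ⟨h1, h2, h3⟩ := (mem_constraintSet_iff hf hg).mp h.1
  obtain ⟨χ, hχ, hχE⟩ := exists_mem_constraintSet hω hσ t g ν
  have hle := h.2 χ hχ
  rw [hχE] at hle
  have k1 := hf.ground_energy_le ω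
  have k2 := hg.ground_energy_le ω
  have k3 : (inner ℂ φ.fst φ.snd).re ≤ ‖φ.fst‖ * ‖φ.snd‖ :=
    (Complex.re_le_norm _).trans (norm_inner_le_norm _ _)
  have k4 := two_mul_norm_mul_norm h1 h2
  have hE := energy_eq hf hg ω t g ν
  rw [hνg, zero_mul, add_zero] at hE
  have k5 : ω / 2 * ‖φ.fst‖ ^ 2 + ω / 2 * ‖φ.snd‖ ^ 2 = ω / 2 := by rw [h1, h2]; ring
  have k6 := mul_le_mul_of_nonneg_left k3 ht.le
  have k7 : t * √(1 - σ ^ 2) = 2 * (t * (‖φ.fst‖ * ‖φ.snd‖)) := by rw [← k4]; ring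
  have hEq : energy ω t g ν φ = ω / 2 - t * √(1 - σ ^ 2) := by linarith
  refine ⟨hEq, ?_⟩
  -- The trial state attains the lower bound, so Cauchy–Schwarz is an equality and the components
  -- are parallel. Their mean positions are then proportional to their weights; since they sum to
  -- zero, both vanish.
  have hin : (inner ℂ φ.fst φ.snd).re = ‖φ.fst‖ * ‖φ.snd‖ :=
    le_antisymm k3 (le_of_mul_le_mul_left (by linarith) ht)
  set a := ‖φ.fst‖ with ha
  set b := ‖φ.snd‖ with hb
  have hpar : (b : ℂ) • φ.fst = (a : ℂ) • φ.snd := by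
    have hns := norm_sub_sq (𝕜 := ℂ) ((b : ℂ) • φ.fst) ((a : ℂ) • φ.snd)
    rw [inner_smul_left, inner_smul_right, Complex.conj_ofReal, RCLike.re_eq_complex_re,
      Complex.re_ofReal_mul, Complex.re_ofReal_mul, hin, norm_smul, norm_smul, Complex.norm_real,
      Complex.norm_real, Real.norm_of_nonneg (norm_nonneg _), Real.norm_of_nonneg (norm_nonneg _),
      ← ha, ← hb] at hns
    rw [← sub_eq_zero, ← norm_eq_zero, ← sq_eq_zero_iff, hns]
    ring
  have hparx : (b : ℂ) • xf = (a : ℂ) • xg := by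
    apply Lp.ext
    filter_upwards [(hf.isPosMul.smul b), (hg.isPosMul.smul a)] with x e1 e2
    rw [e1, e2, hpar]
  have hb2 : b ^ 2 * (inner ℂ φ.fst xf).re = a ^ 2 * (inner ℂ φ.snd xg).re := by
    have hs : ∀ (c : ℝ) (u v : L2), (inner ℂ ((c : ℂ) • u) ((c : ℂ) • v)).re
        = c ^ 2 * (inner ℂ u v).re := by
      intro c u v
      rw [inner_smul_left, inner_smul_right, Complex.conj_ofReal, Complex.re_ofReal_mul,
        Complex.re_ofReal_mul]
      ring
    rw [← hs, ← hs, hpar, hparx]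
  rw [h1, h2] at hb2
  have h4 : (inner ℂ φ.snd xg).re = -(inner ℂ φ.fst xf).re := by linarith
  rw [h4] at hb2
  rw [QRabi.expSigmaZX_eq hf hg, h4]
  linarith

/-! ### Integration along the coupling. -/

/-- A function with a supergradient at every point of an interval is an integral of it. -/
theorem antitoneOn_and_integral_eq_of_supergradient {E D : ℝ → ℝ} {L : ℝ} (hL : 0 ≤ L)
    (h : ∀ a ∈ Set.Icc 0 L, ∀ b ∈ Set.Icc 0 L, E b ≤ E a + (b - a) * D a) :
    AntitoneOn D (Set.Icc 0 L) ∧ ∫ x in (0 : ℝ)..L, D x = E L - E 0 := by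
  have hanti : AntitoneOn D (Set.Icc 0 L) := by
    intro a ha b hb hab
    rcases hab.eq_or_lt with rfl | hlt
    · exact le_rfl
    · have h1 := h a ha b hb
      have h2 := h b hb a ha
      have : (b - a) * D b ≤ (b - a) * D a := by linarith
      exact le_of_mul_le_mul_left this (sub_pos.mpr hlt)
  refine ⟨hanti, ?_⟩
  -- The supergradient inequalities at a and at b sandwich the increment of E. This gives continuity
  -- of E everywhere and the derivative D wherever the antitone D is continuous, that is, off a
  -- countable set.
  have hest : ∀ a ∈ Set.Icc 0 L, ∀ b ∈ Set.Icc 0 L,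
      |E b - E a - (b - a) * D a| ≤ |b - a| * |D b - D a| := by
    intro a ha b hb
    have h1 := h a ha b hb
    have h2 := h b hb a ha
    rw [abs_of_nonpos (by linarith), ← abs_mul]
    refine le_trans ?_ (neg_le_abs _)
    linarith
  have h0L : (0 : ℝ) ∈ Set.Icc 0 L := ⟨le_rfl, hL⟩
  have hLL : L ∈ Set.Icc 0 L := ⟨hL, le_rfl⟩
  have hDb : ∀ a ∈ Set.Icc 0 L, ∀ b ∈ Set.Icc 0 L, |D b - D a| ≤ D 0 - D L := by
    intro a ha b hb
    have := hanti h0L ha ha.1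
    have := hanti h0L hb hb.1
    have := hanti ha hLL ha.2
    have := hanti hb hLL hb.2
    rw [abs_le]
    constructor <;> linarith
  have hcont : ContinuousOn E (Set.Icc 0 L) := by
    intro a ha
    have hz : Tendsto (fun b => |b - a| * (D 0 - D L) + |(b - a) * D a|)
        (𝓝[Set.Icc 0 L] a) (𝓝 0) := by
      have : Continuous fun b : ℝ => |b - a| * (D 0 - D L) + |(b - a) * D a| := by fun_prop
      simpa using (this.tendsto a).mono_left nhdsWithin_le_nhds
    refine tendsto_iff_norm_sub_tendsto_zero.mpr (squeeze_zero' (Eventually.of_forall fun b =>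
      norm_nonneg _) ?_ hz)
    filter_upwards [self_mem_nhdsWithin] with b hb
    have h1 := hest a ha b hb
    have h2 := mul_le_mul_of_nonneg_left (hDb a ha b hb) (abs_nonneg (b - a))
    have h3 := abs_add_le (E b - E a - (b - a) * D a) ((b - a) * D a)
    rw [sub_add_cancel] at h3
    rw [Real.norm_eq_abs]
    linarith
  have hint : IntervalIntegrable D volume 0 L := by
    apply AntitoneOn.intervalIntegrable
    rwa [Set.uIcc_of_le hL]
  refine integral_eq_of_hasDerivAt_off_countable E D
    (s := {x ∈ Set.Icc 0 L | ¬ContinuousWithinAt D (Set.Icc 0 L) x})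
    hanti.countable_not_continuousWithinAt (by rwa [Set.uIcc_of_le hL]) ?_ hint
  intro x hx
  rw [min_eq_left hL, max_eq_right hL] at hx
  have hxI : x ∈ Set.Icc 0 L := Set.Ioo_subset_Icc_self hx.1
  have hnhds : Set.Icc 0 L ∈ 𝓝 x := Icc_mem_nhds hx.1.1 hx.1.2
  have hc : ContinuousAt D x := by
    by_contra hcon
    exact hx.2 ⟨hxI, fun hw => hcon (hw.continuousAt hnhds)⟩
  rw [hasDerivAt_iff_isLittleO, Asymptotics.isLittleO_iff]
  intro ε hε
  filter_upwards [hnhds, Metric.tendsto_nhds.mp hc ε hε] with b hb hbd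
  rw [Real.norm_eq_abs, Real.norm_eq_abs, smul_eq_mul, mul_comm ε]
  exact (hest x hxI b hb).trans (mul_le_mul_of_nonneg_left hbd.le (abs_nonneg _))

end QRabi

/-! ### Assembly of the formula. -/

open QRabi in
theorem mainTheorem4 (ω t g σ : ℝ) (hω : 0 < ω) (ht : 0 < t) (hσ : σ ∈ Set.Icc (-1 : ℝ) 1) :
    (∀ ν : ℝ, ∃ φ : QRabi.State, QRabi.IsOptimizer ω t g ν σ 0 φ ∧ QRabi.IsNonneg φ) ∧
    ∀ lam : ℝ, 0 ≤ lam → ∀ φ : ℝ → QRabi.State,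
      (∀ ν ∈ Set.Icc (0 : ℝ) lam,
        QRabi.IsOptimizer ω t g ν σ 0 (φ ν) ∧ QRabi.IsRealValued (φ ν)) →
      IntervalIntegrable (fun ν => QRabi.hopping (φ ν)) MeasureTheory.volume 0 lam ∧
      ∀ ξ : ℝ,
        IsGLB (QRabi.energy ω t g lam '' QRabi.constraintSet σ ξ)
          (QRabi.levyLieb ω t g lam σ ξ) ∧
        QRabi.levyLieb ω t g lam σ ξ =
          ω / 2 - t * √(1 - σ ^ 2) + ω ^ 2 / 2 * ξ ^ 2 + lam * g * σ * ξ
            - lam ^ 2 * g ^ 2 / (2 * ω ^ 2) * (1 - σ ^ 2)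
            + QRabi.nonExplicit ω t g lam φ := by
  refine ⟨fun ν => ?_, fun lam hlam φ hφ => ?_⟩
  · obtain ⟨φ, hφ⟩ := exists_isOptimizer hω ht hσ g ν
    exact hφ.exists_isNonneg ht
  have hsuper : ∀ a ∈ Set.Icc 0 lam, ∀ b ∈ Set.Icc 0 lam,
      energy ω t g b (φ b) ≤ energy ω t g a (φ a) + (b - a) * (g * expSigmaZX (φ a)) := by
    intro a ha b hb
    rw [← energy_eq_add]
    exact (hφ b hb).1.2 _ (hφ a ha).1.1
  obtain ⟨hanti, hintegral⟩ := antitoneOn_and_integral_eq_of_supergradient hlam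
    (E := fun ν => energy ω t g ν (φ ν)) (D := fun ν => g * expSigmaZX (φ ν)) hsuper
  have huIcc : Set.uIcc 0 lam = Set.Icc 0 lam := Set.uIcc_of_le hlam
  have hωne : ω ≠ 0 := hω.ne'
  have hgD : IntervalIntegrable (fun ν => g * expSigmaZX (φ ν)) MeasureTheory.volume 0 lam :=
    AntitoneOn.intervalIntegrable (by rwa [huIcc])
  have hZ : IntervalIntegrable (fun ν => expSigmaZX (φ ν)) MeasureTheory.volume 0 lam := by
    -- For g = 0 the supergradient carries no information about ⟨σ_z x⟩, but the coupling then
    -- vanishes for every ν, and ⟨σ_z x⟩ with it.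
    rcases eq_or_ne g 0 with rfl | hg
    · refine (intervalIntegrable_const (c := (0 : ℝ))).congr fun ν hν => ?_
      have hν' : ν ∈ Set.Icc 0 lam := huIcc ▸ Set.uIoc_subset_uIcc hν
      exact ((hφ ν hν').1.energy_eq_of_coupling_eq_zero hω ht hσ (mul_zero ν)).2.symm
    · have := hgD.const_mul g⁻¹
      simpa [inv_mul_cancel_left₀ hg] using this
  have hstat : ∀ ν ∈ Set.Icc 0 lam, hopping (φ ν)
      = -(ω ^ 2 / (4 * t)) * expSigmaZX (φ ν) - ν * (g * (1 - σ ^ 2) / (4 * t)) := by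
    intro ν hν
    rw [(hφ ν hν).1.expSigmaZX_eq hω (hφ ν hν).2]
    field_simp
    ring
  have hlin : IntervalIntegrable (fun ν : ℝ => ν * (g * (1 - σ ^ 2) / (4 * t)))
      MeasureTheory.volume 0 lam := (by fun_prop : Continuous _).intervalIntegrable _ _
  have hZc := hZ.const_mul (-(ω ^ 2 / (4 * t)))
  have hhop : IntervalIntegrable (fun ν => hopping (φ ν)) MeasureTheory.volume 0 lam := by
    refine (hZc.sub hlin).congr fun ν hν => ?_
    exact (hstat ν (huIcc ▸ Set.uIoc_subset_uIcc hν)).symm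
  refine ⟨hhop, fun ξ => ?_⟩
  -- The prefactor −4tg/ω² turns the stationarity relation into g⟨σ_z x⟩ plus a term linear in ν;
  -- the former integrates to the energy difference, the latter to the λ²g² term.
  have hI : nonExplicit ω t g lam φ = energy ω t g lam (φ lam) - energy ω t g 0 (φ 0)
      + lam ^ 2 * g ^ 2 / (2 * ω ^ 2) * (1 - σ ^ 2) := by
    have hc : ∫ ν in (0 : ℝ)..lam, hopping (φ ν) = ∫ ν in (0 : ℝ)..lam,
        (-(ω ^ 2 / (4 * t)) * expSigmaZX (φ ν) - ν * (g * (1 - σ ^ 2) / (4 * t))) :=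
      intervalIntegral.integral_congr fun ν hν => hstat ν (huIcc ▸ hν)
    rw [← hintegral, nonExplicit, hc, intervalIntegral.integral_sub hZc hlin,
      intervalIntegral.integral_const_mul, intervalIntegral.integral_const_mul,
      intervalIntegral.integral_mul_const, integral_id]
    field_simp
    ring
  have h0 := ((hφ 0 ⟨le_rfl, hlam⟩).1.energy_eq_of_coupling_eq_zero hω ht hσ (zero_mul g)).1
  have hleast := (hφ lam ⟨hlam, le_rfl⟩).1.isLeast_translate ξ
  have hLL := hleast.isGLB.csInf_eq hleast.nonempty
  refine ⟨?_, ?_⟩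
  · rw [levyLieb, hLL]
    exact hleast.isGLB
  · rw [levyLieb, hLL, hI, h0]
    ring
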